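/- For $p\ge 0$ let $S_p$ be the B-spline subdivision operator of degree $p$, acting on (scalar or vector) sequences $x=(x_i)_{i\in\mathbb Z}$ by $(S_0x)_{2i}=(S_0x)_{2i+1}=x_i$ and $(S_{p+1}x)_K=\frac12\big((S_px)_K+(S_px)_{K+1}\big)$. An operator $S$ on sequences exactly reproduces polynomials of order $P$ with shift parameter $c$ if it maps $(q(i))_{i\in\mathbb Z}$ to $(q(K/2+c))_{K\in\mathbb Z}$ for every real polynomial $q$ of degree $<P$; the shift parameter $c_{S_p}$ of $S_p$ is the one for $P=2$. Let $p\ge3$. Let $\mathcal C\subset\mathbb R^2$ be a closed, non-self-intersecting $C^4$ curve of length $L$ with $L$-periodic arc-length parametrization $\mathbf v(s)$, strictly convex in the sense that its signed curvature is positive everywhere. Let $T$ be a linear subdivision operator, $(Tx)_K=\sum_k a_{K-2k}x_k$ with finitely supported mask $a$, that exactly reproduces polynomials of some order $P_e\ge4$ with shift parameter $c_T=c_{S_p}$. Let $n\ge\lceil p/2\rceil+1$, and let an $(S_p,S_{p-2},T)$ normal multi-scale transform of $\mathcal C$ with $n$ distinct initial points be given, that is: for each level $j\ge0$ points $\mathbf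 v^j_i=\mathbf v(s^j_i)$, $i\in\mathbb Z$, properly ordered along the curve, $s^j_i<s^j_{i+1}$, and periodic, $s^j_{i+2^jn}=s^j_i+L$, such that for all $j\ge1$ and $K\in\mathbb Z$ $$\mathbf v^j_K=\hat{\mathbf v}^j_K+d^j_K\,\hat{\mathbf n}^j_K,\qquad \hat{\mathbf n}^j_K=\frac{(S_{p-2}\Delta\mathbf v^{j-1})_K^{\perp}}{|(S_{p-2}\Delta\mathbf v^{j-1})_K|},\qquad (\Delta\mathbf v^{j-1})_i=\mathbf v^{j-1}_{i+1}-\mathbf v^{j-1}_i,$$ where $d^j_K\in\mathbb R$ are the details and $\hat{\mathbf v}^j_K$ is the orthogonal projection of $(T\mathbf v^{j-1})_K$ onto the line $\{(S_p\mathbf v^{j-1})_K+t\,\hat{\mathbf n}^j_K: t\in\mathbb R\}$. Assume that the transform converges, that is, the piecewise linear interpolants $s^j(t)$ of the data $s^j$ at the grids $2^{-j}\mathbb Z$ converge uniformly to a continuous function as $j\to\infty$. Then $$\|d^j\|_\infty=\sup_{K}|d^j_K|=\mathrm O(2^{-4j}),\qquad j\to\infty .$$ -/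

import Mathlib

open Filter Topology

noncomputable section

namespace NormalMT

/-- The Euclidean plane. -/
abbrev Plane := EuclideanSpace ℝ (Fin 2)

/-- Counterclockwise rotation by a right angle, `w ↦ w^⊥`. -/
def perp (w : Plane) : Plane := !₂[-(w 1), w 0]

/-! ### The curve -/

/-- `γ` is the `L`-periodic arc-length parametrization of a regular `C^1`, closed,
non-self-intersecting planar curve of length `L`. -/
structure IsClosedCurve (γ : ℝ → Plane) (L : ℝ) : Prop where
  length_pos : 0 < L
  contDiff : ContDiff ℝ 1 γ
  periodic : Function.Periodic γ L
  arclength : ∀ s, ‖deriv γ s‖ = 1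
  simple : Set.InjOn γ (Set.Ico 0 L)

/-- Signed curvature of an arc-length parametrized curve: the component of `γ''` along the
unit normal `(γ')^⊥`. -/
def signedCurvature (γ : ℝ → Plane) (s : ℝ) : ℝ :=
  inner ℝ (deriv (deriv γ) s) (perp (deriv γ s))

/-- Strict convexity of a closed curve: the signed curvature is everywhere positive. -/
def StrictlyConvex (γ : ℝ → Plane) : Prop := ∀ s, 0 < signedCurvature γ s

/-! ### Subdivision operators -/

section Operators

variable {V : Type*} [AddCommGroup V] [Module ℝ V]

/-- Forward difference `(Δ x)_i = x_{i+1} - x_i`. -/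
def delta (x : ℤ → V) (i : ℤ) : V := x (i + 1) - x i

/-- The B-spline subdivision operator `S_p` (Lane-Riesenfeld recursion):
`(S_0 x)_{2i} = (S_0 x)_{2i+1} = x_i` and
`(S_{p+1} x)_K = ((S_p x)_K + (S_p x)_{K+1}) / 2`. (`K / 2` on `ℤ` is the floor of the half.) -/
def bspline : ℕ → (ℤ → V) → ℤ → V
  | 0, x, K => x (K / 2)
  | p + 1, x, K => (1 / 2 : ℝ) • (bspline p x K + bspline p x (K + 1))

/-- The linear (local, shift-invariant) subdivision operator with finitely supported mask `a`:
`(T x)_K = ∑_k a_{K - 2k} x_k`, the sum being indexed by `m = K - 2k`. -/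
def subdivision (a : ℤ →₀ ℝ) (x : ℤ → V) (K : ℤ) : V :=
  ∑ m ∈ a.support with (2 : ℤ) ∣ K - m, a m • x ((K - m) / 2)

end Operators

/-- The operator `S` exactly reproduces polynomials of order `P` (that is, of degree `< P`), with
shift parameter `c`: it maps the samples `(q(i))_i` to the samples `(q(K/2 + c))_K`. -/
def ReproducesExactly (S : (ℤ → ℝ) → ℤ → ℝ) (P : ℕ) (c : ℝ) : Prop :=
  ∀ q : Polynomial ℝ, q.degree < (P : WithBot ℕ) →
    ∀ K : ℤ, S (fun i => q.eval (i : ℝ)) K = q.eval ((K : ℝ) / 2 + c)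

/-! ### Combined normal multi-scale transforms -/

/-- The approximate unit normal `(N Δv)_K^⊥ / |(N Δv)_K|` computed from the coarse data `v`. -/
def approxNormal (N : (ℤ → Plane) → ℤ → Plane) (v : ℤ → Plane) (K : ℤ) : Plane :=
  ‖N (delta v) K‖⁻¹ • perp (N (delta v) K)

/-- The predicted point: the orthogonal projection of `(T v)_K` onto the normal line
`(S v)_K + ℝ n_K`. -/
def predicted (S N T : (ℤ → Plane) → ℤ → Plane) (v : ℤ → Plane) (K : ℤ) : Plane :=
  S v K + (inner ℝ (T v K - S v K) (approxNormal N v K) : ℝ) • approxNormal N v K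

/-- The arc-length sequences `s^j` and the scalar details `d^j` (`j ≥ 1`) form an `(S, N, T)` normal
multi-scale transform of the closed curve `γ` of length `L`, whose initial data are `n`
distinct points. The data at level `j` are the points `v^j_i = γ(s^j_i)`.

* `ordered`, `closed`: at each level the data are properly ordered along the curve, and they are
  extended periodically, with `2^j n` points per period;
* `step`: `v^{j+1}_K = (predicted point) + d^{j+1}_K n^{j+1}_K` lies on the curve.

A normal line meets the curve more than once. No rule for choosing among the intersection points is
fixed here other than that the chosen points are properly ordered. -/
structure IsNormalMT (S N T : (ℤ → Plane) → ℤ → Plane) (γ : ℝ → Plane) (L : ℝ) (n : ℕ)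
    (s d : ℕ → ℤ → ℝ) : Prop where
  ordered : ∀ j, StrictMono (s j)
  closed : ∀ j i, s j (i + 2 ^ j * n) = s j i + L
  step : ∀ j K, γ (s (j + 1) K) =
    predicted S N T (fun i => γ (s j i)) K
      + d (j + 1) K • approxNormal N (fun i => γ (s j i)) K

/-- The piecewise linear interpolant of the data `x` at the grid `2^{-j} ℤ`. -/
def interpolant (j : ℕ) (x : ℤ → ℝ) (t : ℝ) : ℝ :=
  x ⌊2 ^ j * t⌋ + Int.fract (2 ^ j * t) * (x (⌊2 ^ j * t⌋ + 1) - x ⌊2 ^ j * t⌋)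

/-- Convergence of a normal multi-scale transform: the arc-length linear interpolants `s^j(t)`
converge uniformly to a continuous function `s(t)`. -/
def Converges (s : ℕ → ℤ → ℝ) : Prop :=
  ∃ σ : ℝ → ℝ, Continuous σ ∧ TendstoUniformly (fun j t => interpolant j (s j) t) σ atTop

end NormalMT

end

noncomputable section

namespace NormalMT

section Operators

variable {V W : Type*} [AddCommGroup V] [Module ℝ V] [AddCommGroup W] [Module ℝ W]

lemma bspline_map (f : V →ₗ[ℝ] W) (p : ℕ) (x : ℤ → V) (K : ℤ) :
    bspline p (fun i => f (x i)) K = f (bspline p x K) := by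
  induction p generalizing K with
  | zero => rfl
  | succ p ih => simp only [bspline, ih, map_smul, map_add]

lemma bspline_add (p : ℕ) (x y : ℤ → V) (K : ℤ) :
    bspline p (fun i => x i + y i) K = bspline p x K + bspline p y K := by
  induction p generalizing K with
  | zero => rfl
  | succ p ih => simp only [bspline, ih, smul_add]; abel

lemma bspline_sub (p : ℕ) (x y : ℤ → V) (K : ℤ) :
    bspline p (fun i => x i - y i) K = bspline p x K - bspline p y K := by
  induction p generalizing K with
  | zero => rfl
  | succ p ih => simp only [bspline, ih, smul_add, smul_sub]; abel

lemma bspline_const (p : ℕ) (v : V) (K : ℤ) : bspline p (fun _ => v) K = v := by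
  induction p generalizing K with
  | zero => rfl
  | succ p ih => simp only [bspline, ih]; rw [← two_smul ℝ, smul_smul]; norm_num

lemma bspline_smul_const (p : ℕ) (x : ℤ → ℝ) (v : V) (K : ℤ) :
    bspline p (fun i => x i • v) K = bspline p x K • v :=
  bspline_map ((LinearMap.id : ℝ →ₗ[ℝ] ℝ).smulRight v) p x K

lemma bspline_const_mul (p : ℕ) (c : ℝ) (x : ℤ → ℝ) (K : ℤ) :
    bspline p (fun i => c * x i) K = c * bspline p x K :=
  bspline_map (c • (LinearMap.id : ℝ →ₗ[ℝ] ℝ)) p x K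

lemma bspline_shift (p : ℕ) (x : ℤ → V) (K : ℤ) :
    bspline p (fun i => x (i + 1)) K = bspline p x (K + 2) := by
  induction p generalizing K with
  | zero =>
    simp only [bspline]
    congr 1; omega
  | succ p ih =>
    simp only [bspline, ih]
    rw [show K + 1 + 2 = K + 2 + 1 by ring]

lemma delta_bspline (p : ℕ) (x : ℤ → V) (K : ℤ) :
    delta (bspline (p + 1) x) K = (1 / 2 : ℝ) • bspline p (delta x) K := by
  have h : bspline p (delta x) K = bspline p x (K + 2) - bspline p x K := by
    rw [← bspline_shift, ← bspline_sub]; rfl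
  rw [h, delta, bspline, bspline, ← smul_sub, show K + 1 + 1 = K + 2 by ring]
  congr 1; abel

lemma norm_bspline_le {E : Type*} [NormedAddCommGroup E] [NormedSpace ℝ E] (p : ℕ)
    {x : ℤ → E} {y : ℤ → ℝ} {K : ℤ} (h : ∀ i, |2 * i - K| ≤ p + 1 → ‖x i‖ ≤ y i) :
    ‖bspline p x K‖ ≤ bspline p y K := by
  induction p generalizing K with
  | zero =>
    apply h
    rw [abs_le]; push_cast; omega
  | succ p ih =>
    have h1 := ih (K := K) fun i hi => h i (by rw [abs_le] at *; push_cast; omega)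
    have h2 := ih (K := K + 1) fun i hi => h i (by rw [abs_le] at *; push_cast; omega)
    simp only [bspline, norm_smul, smul_eq_mul]
    have h3 := norm_add_le (bspline p x K) (bspline p x (K + 1))
    norm_num
    linarith

lemma norm_bspline_le_const {E : Type*} [NormedAddCommGroup E] [NormedSpace ℝ E] (p : ℕ)
    {x : ℤ → E} {C : ℝ} {K : ℤ} (h : ∀ i, |2 * i - K| ≤ p + 1 → ‖x i‖ ≤ C) :
    ‖bspline p x K‖ ≤ C := by
  simpa only [bspline_const] using norm_bspline_le p h

lemma abs_bspline_le (p : ℕ) {x : ℤ → ℝ} {y : ℤ → ℝ} {K : ℤ}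
    (h : ∀ i, |2 * i - K| ≤ p + 1 → |x i| ≤ y i) : |bspline p x K| ≤ bspline p y K := by
  rw [← Real.norm_eq_abs]
  exact norm_bspline_le p h

lemma abs_bspline_le_const (p : ℕ) {x : ℤ → ℝ} {C : ℝ} {K : ℤ}
    (h : ∀ i, |2 * i - K| ≤ p + 1 → |x i| ≤ C) : |bspline p x K| ≤ C := by
  rw [← Real.norm_eq_abs]
  exact norm_bspline_le_const p h

lemma bspline_pos (p : ℕ) {x : ℤ → ℝ} (h : ∀ i, 0 < x i) (K : ℤ) : 0 < bspline p x K := by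
  induction p generalizing K with
  | zero => exact h _
  | succ p ih =>
    have := ih K
    have := ih (K + 1)
    simp only [bspline, smul_eq_mul]
    linarith

/-- Symmetric B-spline schemes reproduce linear polynomials about the point `K / 2 + (p - 1) / 4`. -/
lemma bspline_linear (q : ℕ) (K : ℤ) :
    bspline (q + 1) (fun i => (i : ℝ)) K = K / 2 + q / 4 := by
  induction q generalizing K with
  | zero =>
    obtain ⟨i, rfl | rfl⟩ := Int.even_or_odd' K
    · simp only [bspline, smul_eq_mul]
      rw [show 2 * i / 2 = i by omega, show (2 * i + 1) / 2 = i by omega]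
      push_cast; ring
    · simp only [bspline, smul_eq_mul]
      rw [show (2 * i + 1) / 2 = i by omega, show (2 * i + 1 + 1) / 2 = i + 1 by omega]
      push_cast; ring
  | succ q ih =>
    rw [bspline, ih, ih, smul_eq_mul]
    push_cast; ring

lemma bspline_sq (q : ℕ) (K : ℤ) :
    bspline (q + 3) (fun i => (i : ℝ) ^ 2) K
      = (K / 2 + (q + 2) / 4) ^ 2 + (q + 4) / 16 := by
  induction q generalizing K with
  | zero =>
    obtain ⟨i, rfl | rfl⟩ := Int.even_or_odd' K
    · simp only [bspline, smul_eq_mul]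
      rw [show 2 * i / 2 = i by omega, show (2 * i + 1) / 2 = i by omega,
        show (2 * i + 1 + 1) / 2 = i + 1 by omega, show (2 * i + 1 + 1 + 1) / 2 = i + 1 by omega]
      push_cast; ring
    · simp only [bspline, smul_eq_mul]
      rw [show (2 * i + 1) / 2 = i by omega,
        show (2 * i + 1 + 1) / 2 = i + 1 by omega, show (2 * i + 1 + 1 + 1) / 2 = i + 1 by omega,
        show (2 * i + 1 + 1 + 1 + 1) / 2 = i + 2 by omega]
      push_cast; ring
  | succ q ih =>
    rw [show q + 1 + 3 = (q + 3) + 1 by ring, bspline, ih, ih, smul_eq_mul]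
    push_cast; ring

lemma bspline_cube (q : ℕ) (K : ℤ) :
    bspline (q + 3) (fun i => (i : ℝ) ^ 3) K
      = (K / 2 + (q + 2) / 4) ^ 3 + 3 * ((q + 4) / 16) * (K / 2 + (q + 2) / 4) := by
  induction q generalizing K with
  | zero =>
    obtain ⟨i, rfl | rfl⟩ := Int.even_or_odd' K
    · simp only [bspline, smul_eq_mul]
      rw [show 2 * i / 2 = i by omega, show (2 * i + 1) / 2 = i by omega,
        show (2 * i + 1 + 1) / 2 = i + 1 by omega, show (2 * i + 1 + 1 + 1) / 2 = i + 1 by omega]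
      push_cast; ring
    · simp only [bspline, smul_eq_mul]
      rw [show (2 * i + 1) / 2 = i by omega,
        show (2 * i + 1 + 1) / 2 = i + 1 by omega, show (2 * i + 1 + 1 + 1) / 2 = i + 1 by omega,
        show (2 * i + 1 + 1 + 1 + 1) / 2 = i + 2 by omega]
      push_cast; ring
  | succ q ih =>
    rw [show q + 1 + 3 = (q + 3) + 1 by ring, bspline, ih, ih, smul_eq_mul]
    push_cast; ring

/-- The first and third central moments of the stencils of `S_p`, `p ≥ 3`, vanish. -/
lemma bspline_central_cube (q : ℕ) (K : ℤ) :
    bspline (q + 3) (fun i => ((i : ℝ) - (K / 2 + (q + 2) / 4)) ^ 3) K = 0 := by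
  set κ : ℝ := K / 2 + (q + 2) / 4 with hκ
  have h : (fun i : ℤ => ((i : ℝ) - κ) ^ 3) = fun i : ℤ =>
      ((i : ℝ) ^ 3 + (3 * κ ^ 2) * (i : ℝ)) - ((3 * κ) * (i : ℝ) ^ 2 + κ ^ 3) := by
    funext i; ring
  rw [h, bspline_sub, bspline_add, bspline_add, bspline_const_mul, bspline_const_mul, bspline_const,
    bspline_cube, bspline_sq, show q + 3 = (q + 2) + 1 by ring, bspline_linear]
  push_cast
  rw [← hκ]
  ring

lemma subdivision_add (a : ℤ →₀ ℝ) (x y : ℤ → V) (K : ℤ) :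
    subdivision a (fun i => x i + y i) K = subdivision a x K + subdivision a y K := by
  simp only [subdivision, smul_add, Finset.sum_add_distrib]

lemma subdivision_sub (a : ℤ →₀ ℝ) (x y : ℤ → V) (K : ℤ) :
    subdivision a (fun i => x i - y i) K = subdivision a x K - subdivision a y K := by
  simp only [subdivision, smul_sub, Finset.sum_sub_distrib]

lemma subdivision_map (f : V →ₗ[ℝ] W) (a : ℤ →₀ ℝ) (x : ℤ → V) (K : ℤ) :
    subdivision a (fun i => f (x i)) K = f (subdivision a x K) := by
  simp only [subdivision, map_sum, map_smul]

lemma subdivision_const_mul (a : ℤ →₀ ℝ) (c : ℝ) (x : ℤ → ℝ) (K : ℤ) :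
    subdivision a (fun i => c * x i) K = c * subdivision a x K :=
  subdivision_map (c • (LinearMap.id : ℝ →ₗ[ℝ] ℝ)) a x K

lemma abs_subdivision_le (a : ℤ →₀ ℝ) {R : ℕ} (hR : ∀ m ∈ a.support, |m| ≤ R) {x : ℤ → ℝ} {C : ℝ}
    {K : ℤ} (h : ∀ i, |2 * i - K| ≤ R → |x i| ≤ C) (hC : 0 ≤ C) :
    |subdivision a x K| ≤ (∑ m ∈ a.support, |a m|) * C := by
  rw [subdivision, Finset.sum_mul]
  calc _ ≤ ∑ m ∈ a.support with (2 : ℤ) ∣ K - m, |a m • x ((K - m) / 2)| :=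
        Finset.abs_sum_le_sum_abs _ _
    _ ≤ ∑ m ∈ a.support with (2 : ℤ) ∣ K - m, |a m| * C := by
        refine Finset.sum_le_sum fun m hm => ?_
        rw [Finset.mem_filter] at hm
        rw [smul_eq_mul, abs_mul]
        refine mul_le_mul_of_nonneg_left (h _ ?_) (abs_nonneg _)
        have := hR m hm.1
        rw [abs_le] at *
        omega
    _ ≤ _ := Finset.sum_le_sum_of_subset_of_nonneg (Finset.filter_subset _ _)
        fun m _ _ => mul_nonneg (abs_nonneg _) hC

end Operators

/-- A discrete mean value inequality on a window. -/
lemma abs_sub_le_of_abs_delta_le {z : ℤ → ℝ} {B : ℝ} {i₀ : ℤ} {R : ℕ}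
    (h : ∀ i, |i - i₀| ≤ R → |delta z i| ≤ B) (i : ℤ) (hi : |i - i₀| ≤ R) :
    |z i - z i₀| ≤ R * B := by
  have hB : 0 ≤ B := (abs_nonneg _).trans (h i₀ (by simp))
  have key : ∀ k : ℕ, k ≤ R → |z (i₀ + k) - z i₀| ≤ k * B ∧ |z (i₀ - k) - z i₀| ≤ k * B := by
    intro k
    induction k with
    | zero => simp
    | succ k ih =>
      intro hk
      obtain ⟨h1, h2⟩ := ih (by omega)
      have h3 := h (i₀ + k) (by rw [abs_le]; omega)
      have h4 := h (i₀ - (k + 1)) (by rw [abs_le]; omega)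
      rw [delta] at h3 h4
      rw [show i₀ - ((k : ℤ) + 1) + 1 = i₀ - k by ring] at h4
      push_cast
      rw [← add_assoc]
      rw [abs_le] at h1 h2 h3 h4
      rw [abs_le, abs_le]
      constructor <;> constructor <;> linarith [h1.1, h1.2, h2.1, h2.2, h3.1, h3.2, h4.1, h4.2]
  have hi' : (i - i₀).natAbs ≤ R := by rw [abs_le] at hi; omega
  have h5 : |z i - z i₀| ≤ ((i - i₀).natAbs : ℝ) * B := by
    have := key (i - i₀).natAbs hi'
    rcases Int.natAbs_eq (i - i₀) with h6 | h6
    · have h7 : i₀ + ((i - i₀).natAbs : ℤ) = i := by omega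
      rw [h7] at this; exact this.1
    · have h7 : i₀ - ((i - i₀).natAbs : ℤ) = i := by omega
      rw [h7] at this; exact this.2
  have h8 : ((i - i₀).natAbs : ℝ) ≤ R := by
    exact_mod_cast hi'
  exact h5.trans (mul_le_mul_of_nonneg_right h8 hB)

/-- Newton interpolation of order two. -/
lemma abs_sub_linear_le {s : ℤ → ℝ} {D : ℝ} (h : ∀ i, |delta (delta s) i| ≤ D) (R : ℕ)
    {i₀ i : ℤ} (hi : |i - i₀| ≤ R) :
    |s i - s i₀ - delta s i₀ * (i - i₀)| ≤ R * (R * D) := by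
  have h1 := abs_sub_le_of_abs_delta_le (z := fun i => s i - delta s i₀ * (i - i₀)) (B := R * D)
    (i₀ := i₀) (R := R) (fun k hk => by
      have := abs_sub_le_of_abs_delta_le (z := delta s) (fun i _ => h i) k hk
      have h2 : delta (fun i : ℤ => s i - delta s i₀ * (i - i₀)) k = delta s k - delta s i₀ := by
        simp only [delta]; push_cast; ring
      rwa [h2]) i hi
  have h2 : s i - delta s i₀ * (i - i₀) - (s i₀ - delta s i₀ * (i₀ - i₀))
      = s i - s i₀ - delta s i₀ * (i - i₀) := by ring
  rwa [h2] at h1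

/-- Newton interpolation of order three. -/
lemma abs_sub_quadratic_le {s : ℤ → ℝ} {D : ℝ} (h : ∀ i, |delta (delta (delta s)) i| ≤ D) (R : ℕ)
    {i₀ i : ℤ} (hi : |i - i₀| ≤ R) :
    |s i - s i₀ - delta s i₀ * (i - i₀) - delta (delta s) i₀ * ((i - i₀) * (i - i₀ - 1) / 2)|
      ≤ R * (R * (R * D)) := by
  set b := delta (delta s) i₀ with hb
  set z : ℤ → ℝ := fun i => s i - delta s i₀ * (i - i₀) - b * ((i - i₀) * (i - i₀ - 1) / 2) with hz
  have h1 := abs_sub_le_of_abs_delta_le (z := z) (B := R * (R * D)) (i₀ := i₀) (R := R)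
    (fun k hk => by
      have := abs_sub_linear_le (s := delta s) h R hk
      have h2 : delta z k = delta s k - delta s i₀ - b * (k - i₀) := by
        simp only [hz, delta]; push_cast; ring
      rwa [h2]) i hi
  have h2 : z i - z i₀
      = s i - s i₀ - delta s i₀ * (i - i₀) - b * ((i - i₀) * (i - i₀ - 1) / 2) := by
    simp only [hz]; ring
  rwa [h2] at h1

/-- A perturbed geometric recursion whose perturbation decays faster than the ratio. -/
lemma exists_geometric_bound {u : ℕ → ℤ → ℝ} {q C B : ℝ} (hq : 0 < q) (hC : 0 ≤ C)
    (h0 : ∀ i, |u 0 i| ≤ B)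
    (h : ∀ k e, (∀ i, |u k i| ≤ e) → ∀ i, |u (k + 1) i| ≤ q * e + C * (q / 2) ^ k) :
    ∃ B', 0 ≤ B' ∧ ∀ k i, |u k i| ≤ B' * q ^ k := by
  have hB : 0 ≤ B := (abs_nonneg _).trans (h0 0)
  have key : ∀ k i, |u k i| ≤ q ^ k * (B + 2 * C / q * (1 - (1 / 2) ^ k)) := by
    intro k
    induction k with
    | zero => simpa using h0
    | succ k ih =>
      intro i
      refine (h k _ ih i).trans (le_of_eq ?_)
      simp only [div_pow, one_pow]
      field_simp
      ring
  refine ⟨B + 2 * C / q, by positivity, fun k i => (key k i).trans ?_⟩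
  rw [mul_comm]
  gcongr
  have h1 : 0 ≤ 2 * C / q := by positivity
  have h2 : (0 : ℝ) ≤ (1 / 2) ^ k := by positivity
  nlinarith

/-- Uniform Taylor estimates for a unit speed curve with derivatives `γ₁`, `γ₂`, `γ₃`. -/
structure TaylorBounds (γ γ₁ γ₂ γ₃ : ℝ → Plane) (M : ℝ) : Prop where
  one_le : 1 ≤ M
  norm_one : ∀ t, ‖γ₁ t‖ = 1
  inner_two : ∀ t, inner ℝ (γ₂ t) (γ₁ t) = 0
  norm_two : ∀ t, ‖γ₂ t‖ ≤ M
  norm_three : ∀ t, ‖γ₃ t‖ ≤ M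
  linear : ∀ a t, ‖γ t - γ a - (t - a) • γ₁ a‖ ≤ M * |t - a| ^ 2
  cubic : ∀ a t, ‖γ t - γ a - (t - a) • γ₁ a - ((t - a) ^ 2 / 2) • γ₂ a
    - ((t - a) ^ 3 / 6) • γ₃ a‖ ≤ M * |t - a| ^ 4
  increment : ∀ a t u A, |t - a| ≤ A → |u - a| ≤ A →
    ‖(γ t - γ u) - (t - u) • γ₁ a - (((t - a) ^ 2 - (u - a) ^ 2) / 2) • γ₂ a‖
      ≤ M * A ^ 2 * |t - u|

lemma norm_sub_le_pow_of_deriv {E : Type*} [NormedAddCommGroup E] [NormedSpace ℝ E]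
    {f f' : ℝ → E} {a C : ℝ} {k : ℕ} (hC : 0 ≤ C) (hf : ∀ t, HasDerivAt f (f' t) t)
    (h : ∀ t, ‖f' t‖ ≤ C * |t - a| ^ k) (t : ℝ) : ‖f t - f a‖ ≤ C * |t - a| ^ (k + 1) := by
  have h1 := (convex_uIcc a t).norm_image_sub_le_of_norm_hasDerivWithin_le
    (C := C * |t - a| ^ k) (fun x _ => (hf x).hasDerivWithinAt) (fun x hx => (h x).trans (by
      have : |x - a| ≤ |t - a| := Set.abs_sub_left_of_mem_uIcc hx
      gcongr)) Set.left_mem_uIcc Set.right_mem_uIcc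
  rw [Real.norm_eq_abs] at h1
  rw [pow_succ, ← mul_assoc]
  exact h1

lemma exists_taylorBounds {γ : ℝ → Plane} {L : ℝ} (hγ : IsClosedCurve γ L)
    (hC4 : ContDiff ℝ 4 γ) : ∃ γ₁ γ₂ γ₃ M, TaylorBounds γ γ₁ γ₂ γ₃ M := by
  have hstep : ∀ (m : ℕ) (f : ℝ → Plane), ContDiff ℝ (m + 1 : ℕ) f → Function.Periodic f L →
      (∀ t, HasDerivAt f (deriv f t) t) ∧ ContDiff ℝ m (deriv f) ∧
        Function.Periodic (deriv f) L := by
    intro m f hf hp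
    have h1 := (contDiff_succ_iff_deriv (n := (m : WithTop ℕ∞))).1 (by exact_mod_cast hf)
    refine ⟨fun t => (h1.1 t).hasDerivAt, h1.2.2, fun t => ?_⟩
    rw [← deriv_comp_add_const]
    congr 1
    funext u
    exact hp u
  have hbdd : ∀ f : ℝ → Plane, Continuous f → Function.Periodic f L → ∃ B, ∀ t, ‖f t‖ ≤ B := by
    intro f hf hp
    obtain ⟨B, hB⟩ := (hp.isBounded_of_continuous hγ.length_pos.ne' hf).exists_norm_le
    exact ⟨B, fun t => hB _ ⟨t, rfl⟩⟩
  obtain ⟨d1, c1, p1⟩ := hstep 3 γ (by exact_mod_cast hC4) hγ.periodic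
  obtain ⟨d2, c2, p2⟩ := hstep 2 _ c1 p1
  obtain ⟨d3, c3, p3⟩ := hstep 1 _ c2 p2
  obtain ⟨d4, c4, p4⟩ := hstep 0 _ c3 p3
  set γ₁ := deriv γ
  set γ₂ := deriv γ₁
  set γ₃ := deriv γ₂
  set γ₄ := deriv γ₃
  obtain ⟨B2, hB2⟩ := hbdd _ c2.continuous p2
  obtain ⟨B3, hB3⟩ := hbdd _ c3.continuous p3
  obtain ⟨B4, hB4⟩ := hbdd _ c4.continuous p4
  set M := max 1 (max B2 (max B3 B4)) with hM
  have hM1 : 1 ≤ M := le_max_left _ _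
  have hM0 : 0 ≤ M := zero_le_one.trans hM1
  have h2 : ∀ t, ‖γ₂ t‖ ≤ M := fun t => (hB2 t).trans (by simp [hM])
  have h3 : ∀ t, ‖γ₃ t‖ ≤ M := fun t => (hB3 t).trans (by simp [hM])
  have h4 : ∀ t, ‖γ₄ t‖ ≤ M := fun t => (hB4 t).trans (by simp [hM])
  have hs : ∀ (a t : ℝ), HasDerivAt (fun t => t - a) 1 t := fun a t => (hasDerivAt_id t).sub_const a
  have r1 : ∀ a t, ‖γ₁ t - γ₁ a‖ ≤ M * |t - a| := fun a t => by
    simpa using norm_sub_le_pow_of_deriv (k := 0) (a := a) hM0 d2 (by simpa using h2) t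
  have r2 : ∀ a t, ‖γ₂ t - γ₂ a‖ ≤ M * |t - a| := fun a t => by
    simpa using norm_sub_le_pow_of_deriv (k := 0) (a := a) hM0 d3 (by simpa using h3) t
  have r3 : ∀ a t, ‖γ₃ t - γ₃ a‖ ≤ M * |t - a| := fun a t => by
    simpa using norm_sub_le_pow_of_deriv (k := 0) (a := a) hM0 d4 (by simpa using h4) t
  have e1 : ∀ a t, ‖γ₁ t - γ₁ a - (t - a) • γ₂ a‖ ≤ M * |t - a| ^ 2 := fun a t => by
    have := norm_sub_le_pow_of_deriv (f := fun t => γ₁ t - (t - a) • γ₂ a)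
      (f' := fun t => γ₂ t - (1 : ℝ) • γ₂ a) (k := 1) (a := a) hM0
      (fun t => (d2 t).sub ((hs a t).smul_const _)) (by simpa using r2 a) t
    refine (le_of_eq ?_).trans this
    congr 1; simp; abel
  have e2 : ∀ a t, ‖γ₂ t - γ₂ a - (t - a) • γ₃ a‖ ≤ M * |t - a| ^ 2 := fun a t => by
    have := norm_sub_le_pow_of_deriv (f := fun t => γ₂ t - (t - a) • γ₃ a)
      (f' := fun t => γ₃ t - (1 : ℝ) • γ₃ a) (k := 1) (a := a) hM0
      (fun t => (d3 t).sub ((hs a t).smul_const _)) (by simpa using r3 a) t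
    refine (le_of_eq ?_).trans this
    congr 1; simp; abel
  have hsq : ∀ (a t : ℝ), HasDerivAt (fun t => (t - a) ^ 2 / 2) (t - a) t := fun a t =>
    (((hs a t).pow 2).div_const 2).congr_deriv (by push_cast; ring)
  have hcu : ∀ (a t : ℝ), HasDerivAt (fun t => (t - a) ^ 3 / 6) ((t - a) ^ 2 / 2) t := fun a t =>
    (((hs a t).pow 3).div_const 6).congr_deriv (by push_cast; ring)
  have e3 : ∀ a t, ‖γ₁ t - γ₁ a - (t - a) • γ₂ a - ((t - a) ^ 2 / 2) • γ₃ a‖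
      ≤ M * |t - a| ^ 3 := fun a t => by
    have := norm_sub_le_pow_of_deriv
      (f := fun t => γ₁ t - (t - a) • γ₂ a - ((t - a) ^ 2 / 2) • γ₃ a)
      (f' := fun t => γ₂ t - (1 : ℝ) • γ₂ a - (t - a) • γ₃ a) (k := 2) (a := a) hM0
      (fun t => ((d2 t).sub ((hs a t).smul_const _)).sub ((hsq a t).smul_const _))
      (by simpa using e2 a) t
    refine (le_of_eq ?_).trans this
    congr 1; simp; abel
  refine ⟨γ₁, γ₂, γ₃, M, hM1, hγ.arclength, ?_, h2, h3, ?_, ?_, ?_⟩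
  · intro t
    have h5 := (d2 t).inner ℝ (d2 t)
    have h6 : (fun t => inner ℝ (γ₁ t) (γ₁ t)) = fun _ => (1 : ℝ) := by
      funext t
      rw [real_inner_self_eq_norm_sq, hγ.arclength, one_pow]
    rw [h6] at h5
    have h7 := h5.unique (hasDerivAt_const t (1 : ℝ))
    rw [real_inner_comm] at h7
    change inner ℝ (γ₂ t) (γ₁ t) + inner ℝ (γ₂ t) (γ₁ t) = 0 at h7
    linarith
  · intro a t
    have := norm_sub_le_pow_of_deriv (f := fun t => γ t - (t - a) • γ₁ a)
      (f' := fun t => γ₁ t - (1 : ℝ) • γ₁ a) (k := 1) (a := a) hM0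
      (fun t => (d1 t).sub ((hs a t).smul_const _)) (by simpa using r1 a) t
    refine (le_of_eq ?_).trans this
    congr 1; simp; abel
  · intro a t
    have := norm_sub_le_pow_of_deriv
      (f := fun t => γ t - (t - a) • γ₁ a - ((t - a) ^ 2 / 2) • γ₂ a - ((t - a) ^ 3 / 6) • γ₃ a)
      (f' := fun t => γ₁ t - (1 : ℝ) • γ₁ a - (t - a) • γ₂ a - ((t - a) ^ 2 / 2) • γ₃ a)
      (k := 3) (a := a) hM0
      (fun t => (((d1 t).sub ((hs a t).smul_const _)).sub ((hsq a t).smul_const _)).sub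
        ((hcu a t).smul_const _))
      (by simpa using e3 a) t
    refine (le_of_eq ?_).trans this
    congr 1; simp; abel
  · intro a t u A ht hu
    have h1 := (convex_Icc (a - A) (a + A)).norm_image_sub_le_of_norm_hasDerivWithin_le
      (f := fun t => γ t - (t - a) • γ₁ a - ((t - a) ^ 2 / 2) • γ₂ a)
      (f' := fun t => γ₁ t - (1 : ℝ) • γ₁ a - (t - a) • γ₂ a)
      (C := M * A ^ 2) (x := u) (y := t)
      (fun x _ => (((d1 x).sub ((hs a x).smul_const _)).sub
        ((hsq a x).smul_const _)).hasDerivWithinAt)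
      (fun x hx => by
        have h8 : |x - a| ≤ A := by rw [abs_le]; constructor <;> linarith [hx.1, hx.2]
        rw [one_smul]
        exact (e1 a x).trans (by gcongr))
      (by rw [abs_le] at hu; constructor <;> linarith [hu.1, hu.2])
      (by rw [abs_le] at ht; constructor <;> linarith [ht.1, ht.2])
    rw [Real.norm_eq_abs] at h1
    refine (le_of_eq ?_).trans h1
    congr 1
    module

lemma inner_perp_self (w : Plane) : inner ℝ (perp w) w = 0 := by
  simp [perp, PiLp.inner_apply, Fin.sum_univ_two]; ring

lemma norm_perp (w : Plane) : ‖perp w‖ = ‖w‖ := by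
  simp [perp, EuclideanSpace.norm_eq, Fin.sum_univ_two, add_comm]

variable {γ γ₁ γ₂ γ₃ : ℝ → Plane} {M : ℝ}

/-- The averaged chords are almost parallel to the tangent at `X`. -/
lemma TaylorBounds.norm_bspline_delta_sub_le (hT : TaylorBounds γ γ₁ γ₂ γ₃ M) (r : ℕ) {s : ℤ → ℝ}
    (hs : StrictMono s) {K : ℤ} {X A B : ℝ} (hA : ∀ i, |2 * i - K| ≤ r + 3 → |s i - X| ≤ A)
    (hB : |bspline r (delta fun i => (s i - X) ^ 2) K| ≤ B * bspline r (delta s) K) :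
    ‖bspline r (delta fun i => γ (s i)) K - bspline r (delta s) K • γ₁ X‖
      ≤ M * (B + A ^ 2) * bspline r (delta s) K := by
  have hM := hT.one_le
  set w := bspline r (delta fun i => γ (s i)) K
  set ℓ := bspline r (delta s) K
  set Q := bspline r (delta fun i => (s i - X) ^ 2) K
  have h1 : ‖bspline r (fun i => (delta (fun i => γ (s i)) i - delta s i • γ₁ X)
      - delta (fun i => (s i - X) ^ 2) i • ((1 / 2 : ℝ) • γ₂ X)) K‖
      ≤ bspline r (fun i => (M * A ^ 2) * delta s i) K := by
    refine norm_bspline_le r fun i hi => ?_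
    have h2 := hT.increment X (s (i + 1)) (s i) A
      (hA _ (by rw [abs_le] at *; omega)) (hA _ (by rw [abs_le] at *; omega))
    have h3 : 0 < s (i + 1) - s i := sub_pos.2 (hs (by omega))
    rw [abs_of_pos h3] at h2
    refine (le_of_eq ?_).trans h2
    congr 1
    simp only [delta]
    module
  rw [bspline_sub, bspline_sub, bspline_smul_const, bspline_smul_const, bspline_const_mul] at h1
  change ‖(w - ℓ • γ₁ X) - Q • ((1 / 2 : ℝ) • γ₂ X)‖ ≤ M * A ^ 2 * ℓ at h1
  have h4 : ‖Q • ((1 / 2 : ℝ) • γ₂ X)‖ ≤ (B * ℓ) * M := by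
    rw [norm_smul, norm_smul, Real.norm_eq_abs]
    have := hT.norm_two X
    have h5 : ‖(1 / 2 : ℝ)‖ * ‖γ₂ X‖ ≤ M := by
      norm_num; linarith
    exact mul_le_mul hB h5 (by positivity) ((abs_nonneg _).trans hB)
  calc ‖w - ℓ • γ₁ X‖ = ‖((w - ℓ • γ₁ X) - Q • ((1 / 2 : ℝ) • γ₂ X))
        + Q • ((1 / 2 : ℝ) • γ₂ X)‖ := by congr 1; abel
    _ ≤ _ := (norm_add_le _ _).trans (add_le_add h1 h4)
    _ = _ := by ring

lemma TaylorBounds.norm_chord_le (hT : TaylorBounds γ γ₁ γ₂ γ₃ M) (a t : ℝ) :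
    ‖γ t - γ a‖ ≤ |t - a| + M * |t - a| ^ 2 := by
  calc ‖γ t - γ a‖ = ‖(t - a) • γ₁ a + (γ t - γ a - (t - a) • γ₁ a)‖ := by congr 1; abel
    _ ≤ ‖(t - a) • γ₁ a‖ + M * |t - a| ^ 2 :=
        (norm_add_le _ _).trans (add_le_add le_rfl (hT.linear a t))
    _ = _ := by rw [norm_smul, hT.norm_one, mul_one, Real.norm_eq_abs]

lemma bspline_sub_self_apply (p : ℕ) (s : ℤ → ℝ) (K : ℤ) :
    bspline p (fun i => s i - bspline p s K) K = 0 := by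
  rw [bspline_sub, bspline_const, sub_self]

/-- A point of the curve on the normal line through the averaged point is close to the point with
the averaged parameter. -/
lemma TaylorBounds.abs_sub_bspline_le (hT : TaylorBounds γ γ₁ γ₂ γ₃ M) {p : ℕ} {s : ℤ → ℝ} {K : ℤ}
    {X t A B θ ℓ : ℝ} {w : Plane} (hX : X = bspline p s K)
    (hA : ∀ i, |2 * i - K| ≤ p + 1 → |s i - X| ≤ A)
    (hB : |bspline p (fun i => (s i - X) ^ 3) K| ≤ B) (hℓ : 0 < ℓ)
    (hw : ‖w - ℓ • γ₁ X‖ ≤ θ * ℓ) (hθ : θ ≤ 1 / 4) (ht : M * |t - X| ≤ 1 / 4)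
    (horth : inner ℝ (γ t - bspline p (fun i => γ (s i)) K) w = 0) :
    |t - X| ≤ 3 * M * (B + A ^ 4 + θ * A ^ 2) := by
  have hM := hT.one_le
  have hθ0 : 0 ≤ θ := by
    by_contra h
    push Not at h
    have := (norm_nonneg _).trans hw
    nlinarith
  set V := bspline p (fun i => γ (s i)) K with hV
  have hx : bspline p (fun i => s i - X) K = 0 := by rw [hX]; exact bspline_sub_self_apply p s K
  have h1 : ‖V - γ X‖ ≤ M * A ^ 2 := by
    have h := norm_bspline_le_const p (x := fun i => γ (s i) - γ X - (s i - X) • γ₁ X)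
      (C := M * A ^ 2) (K := K) (fun i hi => (hT.linear X (s i)).trans (by
        have := hA i hi
        gcongr))
    rwa [bspline_sub, bspline_sub, bspline_smul_const, bspline_const, hx, zero_smul, sub_zero] at h
  have h2 : |inner ℝ (V - γ X) (γ₁ X)| ≤ M * B + M * A ^ 4 := by
    have h := norm_bspline_le_const p (x := fun i => γ (s i) - γ X - (s i - X) • γ₁ X
        - (s i - X) ^ 2 • ((1 / 2 : ℝ) • γ₂ X) - (s i - X) ^ 3 • ((1 / 6 : ℝ) • γ₃ X))
      (C := M * A ^ 4) (K := K) (fun i hi => by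
        have h3 := hA i hi
        refine (le_of_eq ?_).trans ((hT.cubic X (s i)).trans (b := M * |s i - X| ^ 4) (by gcongr))
        congr 1
        module)
    rw [bspline_sub, bspline_sub, bspline_sub, bspline_sub, bspline_smul_const, bspline_smul_const,
      bspline_smul_const, bspline_const, hx, zero_smul, sub_zero] at h
    set Q := bspline p (fun i => (s i - X) ^ 2) K
    set G := bspline p (fun i => (s i - X) ^ 3) K
    set rem := V - γ X - Q • ((1 / 2 : ℝ) • γ₂ X) - G • ((1 / 6 : ℝ) • γ₃ X) with hrem
    have h4 : V - γ X = rem + Q • ((1 / 2 : ℝ) • γ₂ X) + G • ((1 / 6 : ℝ) • γ₃ X) := by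
      rw [hrem]; abel
    rw [h4, inner_add_left, inner_add_left, real_inner_smul_left, real_inner_smul_left, hT.inner_two,
      real_inner_smul_left, real_inner_smul_left]
    have h5 : |inner ℝ rem (γ₁ X)| ≤ M * A ^ 4 := by
      refine (abs_real_inner_le_norm _ _).trans ?_
      rw [hT.norm_one, mul_one]; exact h
    have h6 : |inner ℝ (γ₃ X) (γ₁ X)| ≤ M := by
      refine (abs_real_inner_le_norm _ _).trans ?_
      rw [hT.norm_one, mul_one]; exact hT.norm_three X
    have h7 : |G * (1 / 6 * inner ℝ (γ₃ X) (γ₁ X))| ≤ B * M := by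
      rw [abs_mul, abs_mul]
      refine mul_le_mul hB ?_ (by positivity) ((abs_nonneg _).trans hB)
      have : |(1 / 6 : ℝ)| = 1 / 6 := by norm_num
      rw [this]
      linarith [abs_nonneg (inner ℝ (γ₃ X) (γ₁ X))]
    rw [mul_zero, mul_zero, add_zero]
    refine (abs_add_le _ _).trans ?_
    linarith
  have h3 : |inner ℝ (γ t - γ X) (γ₁ X) - (t - X)| ≤ M * |t - X| ^ 2 := by
    have h : inner ℝ (γ t - γ X) (γ₁ X) - (t - X)
        = inner ℝ (γ t - γ X - (t - X) • γ₁ X) (γ₁ X) := by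
      rw [inner_sub_left (γ t - γ X), real_inner_smul_left, real_inner_self_eq_norm_sq, hT.norm_one]
      ring
    rw [h]
    refine (abs_real_inner_le_norm _ _).trans ?_
    rw [hT.norm_one, mul_one]
    exact hT.linear X t
  set E := γ t - V with hE
  have hE1 : E = (γ t - γ X) - (V - γ X) := by rw [hE]; abel
  have h4 : |inner ℝ E (γ₁ X)| ≤ θ * ‖E‖ := by
    have h : ℓ * inner ℝ E (γ₁ X) = - inner ℝ E (w - ℓ • γ₁ X) := by
      rw [inner_sub_right, horth, real_inner_smul_right]; ring
    have h' : ℓ * |inner ℝ E (γ₁ X)| ≤ ‖E‖ * (θ * ℓ) := by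
      rw [← abs_of_pos hℓ, ← abs_mul, h, abs_neg, abs_of_pos hℓ]
      exact (abs_real_inner_le_norm _ _).trans (by gcongr)
    refine le_of_mul_le_mul_left (h'.trans (le_of_eq ?_)) hℓ
    ring
  have h5 : ‖E‖ ≤ 5 / 4 * |t - X| + M * A ^ 2 := by
    rw [hE1]
    refine (norm_sub_le _ _).trans ?_
    have := hT.norm_chord_le X t
    nlinarith [abs_nonneg (t - X)]
  have h6 : inner ℝ E (γ₁ X) = inner ℝ (γ t - γ X) (γ₁ X) - inner ℝ (V - γ X) (γ₁ X) := by
    rw [hE1, inner_sub_left]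
  have h7 : |t - X| ≤ M * |t - X| ^ 2 + (M * B + M * A ^ 4) + θ * ‖E‖ := by
    have e : t - X = inner ℝ E (γ₁ X) + inner ℝ (V - γ X) (γ₁ X)
        - (inner ℝ (γ t - γ X) (γ₁ X) - (t - X)) := by rw [h6]; ring
    calc |t - X| = _ := congrArg abs e
      _ ≤ |inner ℝ E (γ₁ X)| + |inner ℝ (V - γ X) (γ₁ X)|
          + |inner ℝ (γ t - γ X) (γ₁ X) - (t - X)| :=
        (abs_sub _ _).trans (add_le_add (abs_add_le _ _) le_rfl)
      _ ≤ _ := by linarith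
  have h8 : M * |t - X| ^ 2 ≤ 1 / 4 * |t - X| := by nlinarith [abs_nonneg (t - X)]
  have h9 : θ * ‖E‖ ≤ 5 / 16 * |t - X| + θ * (M * A ^ 2) := by
    have : θ * ‖E‖ ≤ θ * (5 / 4 * |t - X| + M * A ^ 2) := by gcongr
    nlinarith [abs_nonneg (t - X)]
  have hB0 : 0 ≤ B := (abs_nonneg _).trans hB
  have h10 : 0 ≤ M * B + M * A ^ 4 + θ * (M * A ^ 2) := by positivity
  linarith

/-- The detail of a normal multi-scale step in terms of local data. -/
lemma TaylorBounds.abs_detail_le (hT : TaylorBounds γ γ₁ γ₂ γ₃ M) {S N : (ℤ → Plane) → ℤ → Plane}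
    {a : ℤ →₀ ℝ} {R : ℕ} (hR : ∀ m ∈ a.support, |m| ≤ R) {s : ℤ → ℝ} {K : ℤ}
    {X t A θ ℓ d : ℝ} (h1 : subdivision a (fun _ => (1 : ℝ)) K = 1)
    (hA : ∀ i, |2 * i - K| ≤ R → |s i - X| ≤ A) (hℓ : 0 < ℓ)
    (hw : ‖N (delta fun i => γ (s i)) K - ℓ • γ₁ X‖ ≤ θ * ℓ) (hθ : θ ≤ 1 / 4)
    (ht : M * |t - X| ≤ 1 / 4)
    (hstep : γ t = predicted S N (subdivision a) (fun i => γ (s i)) K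
      + d • approxNormal N (fun i => γ (s i)) K) :
    |d| ≤ 2 * |t - X| + θ * |subdivision a (fun i => s i - X) K|
      + M * |subdivision a (fun i => (s i - X) ^ 2) K|
      + M * |subdivision a (fun i => (s i - X) ^ 3) K|
      + (∑ m ∈ a.support, |a m|) * (M * A ^ 4) := by
  have hM := hT.one_le
  rw [predicted] at hstep
  set w := N (delta fun i => γ (s i)) K with hwdef
  set u := approxNormal N (fun i => γ (s i)) K with hu
  set V := S (fun i => γ (s i)) K
  set U := subdivision a (fun i => γ (s i)) K with hU
  have hw0 : 0 < ‖w‖ := by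
    have h2 : ‖ℓ • γ₁ X‖ = ℓ := by
      rw [norm_smul, hT.norm_one, mul_one, Real.norm_eq_abs, abs_of_pos hℓ]
    have h3 := norm_sub_norm_le (ℓ • γ₁ X) w
    rw [norm_sub_rev, h2] at h3
    nlinarith
  have hun : ‖u‖ = 1 := by
    rw [hu, approxNormal, norm_smul, norm_perp, norm_inv, norm_norm]
    exact inv_mul_cancel₀ hw0.ne'
  have huw : inner ℝ u w = 0 := by
    rw [hu, approxNormal, real_inner_smul_left, inner_perp_self, mul_zero]
  have hT1 : |inner ℝ (γ₁ X) u| ≤ θ := by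
    have h : ℓ * inner ℝ (γ₁ X) u = - inner ℝ (w - ℓ • γ₁ X) u := by
      rw [inner_sub_left, real_inner_comm u w, huw, real_inner_smul_left]; ring
    have h' : ℓ * |inner ℝ (γ₁ X) u| ≤ θ * ℓ := by
      rw [← abs_of_pos hℓ, ← abs_mul, h, abs_neg, abs_of_pos hℓ]
      refine (abs_real_inner_le_norm _ _).trans ?_
      rw [hun, mul_one]
      exact hw
    refine le_of_mul_le_mul_left (h'.trans (le_of_eq ?_)) hℓ
    ring
  have hd : d = inner ℝ (γ t - γ X) u - inner ℝ (U - γ X) u := by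
    rw [← inner_sub_left, hstep, show V + (inner ℝ (U - V) u : ℝ) • u + d • u - γ X - (U - γ X)
      = (inner ℝ (U - V) u : ℝ) • u + d • u - (U - V) by abel, inner_sub_left, inner_add_left,
      real_inner_smul_left, real_inner_smul_left, real_inner_self_eq_norm_sq, hun]
    ring
  have hc : ∀ v : Plane, |inner ℝ v u| ≤ ‖v‖ := fun v => by
    simpa [hun] using abs_real_inner_le_norm v u
  have hA0 : 0 ≤ A ^ 4 := by positivity
  set T1 := subdivision a (fun i => s i - X) K
  set T2 := subdivision a (fun i => (s i - X) ^ 2) K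
  set T3 := subdivision a (fun i => (s i - X) ^ 3) K
  have hmain := abs_subdivision_le a hR (K := K) (C := M * A ^ 4)
    (x := fun i => inner ℝ (γ (s i)) u - inner ℝ (γ X) u * 1
      - inner ℝ (γ₁ X) u * (s i - X) - (inner ℝ (γ₂ X) u / 2) * (s i - X) ^ 2
      - (inner ℝ (γ₃ X) u / 6) * (s i - X) ^ 3) (fun i hi => by
        have h3 := hA i hi
        have h4 : M * |s i - X| ^ 4 ≤ M * A ^ 4 := by gcongr
        refine (le_of_eq ?_).trans (((hc _).trans (hT.cubic X (s i))).trans h4)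
        congr 1
        simp only [inner_sub_left, real_inner_smul_left]
        ring) (by positivity)
  have hmap : subdivision a (fun i => inner ℝ (γ (s i)) u) K = inner ℝ U u := by
    have := subdivision_map (innerₗ Plane u) a (fun i => γ (s i)) K
    simp only [innerₗ_apply_apply] at this
    rw [real_inner_comm, ← this]
    simp only [real_inner_comm]
  rw [subdivision_sub, subdivision_sub, subdivision_sub, subdivision_sub, subdivision_const_mul,
    subdivision_const_mul, subdivision_const_mul, subdivision_const_mul, hmap, h1, mul_one] at hmain
  have hy : |inner ℝ (γ t - γ X) u| ≤ 2 * |t - X| := by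
    refine ((hc _).trans (hT.norm_chord_le X t)).trans ?_
    nlinarith [abs_nonneg (t - X)]
  have b1 : |inner ℝ (γ₁ X) u * T1| ≤ θ * |T1| := by rw [abs_mul]; gcongr
  have b2 : |inner ℝ (γ₂ X) u / 2 * T2| ≤ M * |T2| := by
    rw [abs_mul, abs_div, abs_two]
    have h3 := (hc (γ₂ X)).trans (hT.norm_two X)
    gcongr
    linarith [abs_nonneg (inner ℝ (γ₂ X) u)]
  have b3 : |inner ℝ (γ₃ X) u / 6 * T3| ≤ M * |T3| := by
    rw [abs_mul, abs_div, show |(6 : ℝ)| = 6 by norm_num]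
    have h3 := (hc (γ₃ X)).trans (hT.norm_three X)
    gcongr
    linarith [abs_nonneg (inner ℝ (γ₃ X) u)]
  rw [hd, inner_sub_left U]
  rw [abs_le] at hmain hy b1 b2 b3 ⊢
  constructor <;> linarith [hmain.1, hmain.2, hy.1, hy.2, b1.1, b1.2, b2.1, b2.2, b3.1, b3.2]

/-- The abscissa of the point `K` of `S_{q+3}`: the coarse index scale, recentred at it. -/
def centered (q : ℕ) (K i : ℤ) : ℝ := i - (K / 2 + (q + 2) / 4)

lemma bspline_centered (q : ℕ) (K : ℤ) : bspline (q + 3) (fun i => centered q K i) K = 0 := by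
  simp only [centered]
  rw [bspline_sub, bspline_const, show q + 3 = (q + 2) + 1 by ring, bspline_linear]
  push_cast; ring

lemma bspline_two_centered (q : ℕ) (K : ℤ) :
    bspline (q + 1) (fun i => 2 * centered q K i + 1) K = 0 := by
  simp only [centered]
  rw [bspline_add, bspline_const_mul, bspline_sub, bspline_const, bspline_const, bspline_linear]
  ring

lemma abs_centered_le {q R : ℕ} (hR : q + 6 ≤ R) {K i : ℤ} (hi : |2 * i - K| ≤ R) :
    |centered q K i| ≤ R := by
  have h1 : |(2 * i - K : ℝ)| ≤ R := by exact_mod_cast hi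
  have h2 : (q + 6 : ℝ) ≤ R := by exact_mod_cast hR
  have h3 : (0 : ℝ) ≤ q := by positivity
  rw [centered]
  rw [abs_le] at *
  constructor <;> linarith [h1.1, h1.2]

lemma abs_sub_half_le {R : ℕ} {K i : ℤ} (hi : |2 * i - K| ≤ R) : |i - K / 2| ≤ R := by
  rw [abs_le] at *
  omega

lemma abs_sub_bspline_linear_le {q R : ℕ} (hR : q + 6 ≤ R) {s : ℤ → ℝ} {D : ℝ}
    (hD : ∀ i, |delta (delta s) i| ≤ D) {K i : ℤ} (hi : |2 * i - K| ≤ R) :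
    |s i - bspline (q + 3) s K - delta s (K / 2) * centered q K i| ≤ 2 * (R * (R * D)) := by
  set m := delta s (K / 2)
  set f : ℤ → ℝ := fun i => s i - s (K / 2) - m * (i - (K / 2 : ℤ)) with hf
  have h1 : ∀ i, |2 * i - K| ≤ R → |f i| ≤ R * (R * D) := fun i hi =>
    abs_sub_linear_le hD R (abs_sub_half_le hi)
  have h2 : |bspline (q + 3) f K| ≤ R * (R * D) :=
    abs_bspline_le_const _ fun i hi => h1 i (by push_cast at hi; omega)
  have h3 : bspline (q + 3) f K = bspline (q + 3) s K - s (K / 2)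
      - m * ((K / 2 + (q + 2) / 4) - (K / 2 : ℤ)) := by
    rw [hf, bspline_sub, bspline_sub, bspline_const_mul, bspline_sub, bspline_const, bspline_const,
      show q + 3 = (q + 2) + 1 by ring, bspline_linear]
    push_cast; ring
  have h4 : s i - bspline (q + 3) s K - m * centered q K i = f i - bspline (q + 3) f K := by
    rw [h3, hf, centered]; ring
  rw [h4]
  refine (abs_sub _ _).trans ?_
  linarith [h1 i hi]

lemma abs_cube_sub_cube_le {a b A : ℝ} (ha : |a| ≤ A) (hb : |b| ≤ A) :
    |a ^ 3 - b ^ 3| ≤ 3 * A ^ 2 * |a - b| := by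
  rw [show a ^ 3 - b ^ 3 = (a ^ 2 + a * b + b ^ 2) * (a - b) by ring, abs_mul]
  refine mul_le_mul_of_nonneg_right ?_ (abs_nonneg _)
  have h1 : |a ^ 2| ≤ A ^ 2 := by rw [abs_pow]; gcongr
  have h2 : |b ^ 2| ≤ A ^ 2 := by rw [abs_pow]; gcongr
  have h3 : |a * b| ≤ A ^ 2 := by rw [abs_mul, sq]; gcongr; exact (abs_nonneg _).trans ha
  have := abs_add_le (a ^ 2 + a * b) (b ^ 2)
  have := abs_add_le (a ^ 2) (a * b)
  linarith

lemma abs_bspline_cube_le {q R : ℕ} (hR : q + 6 ≤ R) {s : ℤ → ℝ} {A D : ℝ} {K : ℤ}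
    (hm : |delta s (K / 2)| * R ≤ A)
    (hA : ∀ i, |2 * i - K| ≤ R → |s i - bspline (q + 3) s K| ≤ A)
    (hD : ∀ i, |delta (delta s) i| ≤ D) :
    |bspline (q + 3) (fun i => (s i - bspline (q + 3) s K) ^ 3) K|
      ≤ 3 * A ^ 2 * (2 * (R * (R * D))) := by
  set m := delta s (K / 2)
  set X := bspline (q + 3) s K
  have h1 : bspline (q + 3) (fun i => (s i - X) ^ 3) K
      = bspline (q + 3) (fun i => (s i - X) ^ 3 - m ^ 3 * centered q K i ^ 3) K := by
    rw [bspline_sub, bspline_const_mul]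
    simp only [centered]
    rw [bspline_central_cube, mul_zero, sub_zero]
  rw [h1]
  refine abs_bspline_le_const _ fun i hi => ?_
  have hi' : |2 * i - K| ≤ R := by push_cast at hi; omega
  rw [← mul_pow]
  refine (abs_cube_sub_cube_le (hA i hi') ?_).trans ?_
  · rw [abs_mul]
    exact (mul_le_mul_of_nonneg_left (abs_centered_le hR hi') (abs_nonneg _)).trans hm
  · have := abs_sub_bspline_linear_le hR hD hi'
    gcongr

/-- The averaged direction is tangential up to second order, uniformly in the step length. -/
lemma abs_bspline_delta_sq_le {q R : ℕ} (hR : q + 6 ≤ R) {s : ℤ → ℝ} (hs : StrictMono s) {D : ℝ}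
    (hD : ∀ i, |delta (delta s) i| ≤ D) (K : ℤ) :
    |bspline (q + 1) (delta fun i => (s i - bspline (q + 3) s K) ^ 2) K|
      ≤ ((12 * R + 2) * (2 * (R * (R * D)))) * bspline (q + 1) (delta s) K := by
  set m := delta s (K / 2) with hm
  set X := bspline (q + 3) s K
  set E : ℝ := 2 * (R * (R * D)) with hE
  have hD0 : 0 ≤ D := (abs_nonneg _).trans (hD 0)
  have hE0 : 0 ≤ E := by positivity
  have hR1 : (6 : ℝ) ≤ R := by exact_mod_cast (by omega : 6 ≤ R)
  have hm0 : 0 < m := sub_pos.2 (hs (by omega))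
  have hwin : ∀ i, |2 * i - K| ≤ ((q + 1 : ℕ) : ℤ) + 1 →
      |2 * i - K| ≤ R ∧ |2 * (i + 1) - K| ≤ R := fun i hi => by
    rw [abs_le] at hi; rw [abs_le, abs_le]; push_cast at hi; omega
  have hlin : ∀ i, |2 * i - K| ≤ R → |s i - X - m * centered q K i| ≤ E := fun i hi =>
    abs_sub_bspline_linear_le hR hD hi
  have hnext : ∀ i, centered q K (i + 1) = centered q K i + 1 := fun i => by
    simp only [centered]; push_cast; ring
  rcases le_or_gt (4 * E) m with hcase | hcase
  · have h0 : bspline (q + 1) (delta fun i => (s i - X) ^ 2) K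
        = bspline (q + 1) (fun i => delta (fun i => (s i - X) ^ 2) i
          - m ^ 2 * (2 * centered q K i + 1)) K := by
      rw [bspline_sub, bspline_const_mul, bspline_two_centered, mul_zero, sub_zero]
    rw [h0, ← bspline_const_mul]
    refine abs_bspline_le _ fun i hi => ?_
    obtain ⟨w1, w2⟩ := hwin i hi
    set ξ := centered q K i with hξ
    have hξR : |ξ| ≤ R := abs_centered_le hR w1
    have l1 := hlin i w1
    have l2 := hlin (i + 1) w2
    rw [hnext] at l2
    set r1 := s i - X - m * ξ with hr1
    set r2 := s (i + 1) - X - m * (ξ + 1) with hr2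
    have hds : delta s i = m + (r2 - r1) := by rw [hr1, hr2, delta]; ring
    have hid : delta (fun i => (s i - X) ^ 2) i - m ^ 2 * (2 * ξ + 1)
        = m * ((2 * ξ + 1) * (r2 - r1)) + (r1 + r2) * delta s i := by
      rw [hds, hr1, hr2]; simp only [delta]; ring
    rw [hid]
    have hdiff : |r2 - r1| ≤ 2 * E := (abs_sub _ _).trans (by linarith)
    have hsum : |r1 + r2| ≤ 2 * E := (abs_add_le _ _).trans (by linarith)
    have hm2 : m ≤ 2 * delta s i := by rw [hds]; linarith [(abs_le.1 hdiff).1]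
    have hds0 : 0 < delta s i := by linarith
    have hξ1 : |2 * ξ + 1| ≤ 3 * R := by
      rw [abs_le] at *; constructor <;> linarith [hξR.1, hξR.2]
    have t1 : |m * ((2 * ξ + 1) * (r2 - r1))| ≤ 2 * delta s i * ((3 * R) * (2 * E)) := by
      rw [abs_mul, abs_mul, abs_of_pos hm0]
      gcongr
    have t2 : |(r1 + r2) * delta s i| ≤ 2 * E * delta s i := by
      rw [abs_mul, abs_of_pos hds0]; gcongr
    refine ((abs_add_le _ _).trans (add_le_add t1 t2)).trans (le_of_eq ?_)
    ring
  · rw [← bspline_const_mul]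
    refine abs_bspline_le _ fun i hi => ?_
    obtain ⟨w1, w2⟩ := hwin i hi
    have hx : ∀ i, |2 * i - K| ≤ R → |s i - X| ≤ 4 * E * R + E := fun i hi => by
      have h1 := hlin i hi
      have h2 : |m * centered q K i| ≤ 4 * E * R := by
        rw [abs_mul, abs_of_pos hm0]
        exact mul_le_mul hcase.le (abs_centered_le hR hi) (abs_nonneg _) (by positivity)
      calc |s i - X| = |(s i - X - m * centered q K i) + m * centered q K i| := by congr 1; ring
        _ ≤ _ := (abs_add_le _ _).trans (by linarith)
    have hds0 : 0 < delta s i := sub_pos.2 (hs (by omega))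
    have hid : delta (fun i => (s i - X) ^ 2) i = ((s i - X) + (s (i + 1) - X)) * delta s i := by
      simp only [delta]; ring
    rw [hid, abs_mul, abs_of_pos hds0]
    refine mul_le_mul_of_nonneg_right ?_ hds0.le
    refine (abs_add_le _ _).trans ((add_le_add (hx i w1) (hx _ w2)).trans ?_)
    nlinarith

lemma exists_quadratic_approx {q R : ℕ} (hR : q + 6 ≤ R) {s : ℤ → ℝ} {C h : ℝ} (hh : 0 ≤ h)
    (hh1 : h ≤ 1) (hD1 : ∀ i, |delta s i| ≤ C * h) (hD2 : ∀ i, |delta (delta s) i| ≤ C * h ^ 2)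
    (hD3 : ∀ i, |delta (delta (delta s)) i| ≤ C * h ^ 3) (K : ℤ) :
    ∃ m b e : ℝ, |m| ≤ 4 * R ^ 3 * C * h ∧ |b| ≤ 4 * R ^ 3 * C * h ^ 2 ∧
      |e| ≤ 4 * R ^ 3 * C * h ^ 2 ∧ ∀ i, |2 * i - K| ≤ R →
      |s i - bspline (q + 3) s K - (m * centered q K i + b * centered q K i ^ 2 + e)|
        ≤ 4 * R ^ 3 * C * h ^ 3 := by
  set i₀ := K / 2 with hi₀
  set m₀ := delta s i₀ with hm₀
  set b₀ := delta (delta s) i₀ with hb₀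
  set X := bspline (q + 3) s K with hX
  set κ : ℝ := K / 2 + (q + 2) / 4 with hκ
  set f : ℝ := κ - i₀ with hf
  have hC : 0 ≤ C * h := (abs_nonneg _).trans (hD1 0)
  have hC2 : 0 ≤ C * h ^ 2 := (abs_nonneg _).trans (hD2 0)
  have hC3 : 0 ≤ C * h ^ 3 := (abs_nonneg _).trans (hD3 0)
  have hle : C * h ^ 2 ≤ C * h := by nlinarith
  have hle3 : C * h ^ 3 ≤ C * h ^ 2 := by nlinarith
  have hR1 : (6 : ℝ) ≤ R := by exact_mod_cast (by omega : 6 ≤ R)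
  have hR2 : (q + 6 : ℝ) ≤ R := by exact_mod_cast hR
  have hq0 : (0 : ℝ) ≤ q := by positivity
  have hfb : 0 ≤ f ∧ 2 * f ≤ R := by
    have e1 : 2 * i₀ ≤ K := by omega
    have e2 : K ≤ 2 * i₀ + 1 := by omega
    have e1' : (2 * i₀ : ℝ) ≤ K := by exact_mod_cast e1
    have e2' : (K : ℝ) ≤ 2 * i₀ + 1 := by exact_mod_cast e2
    rw [hf, hκ]
    constructor <;> linarith
  have hR0 : (1 : ℝ) ≤ R := by linarith
  have hR3 : (1 : ℝ) ≤ (R : ℝ) ^ 3 := one_le_pow₀ hR0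
  have hb₀D := hD2 i₀
  have hb : |b₀ / 2| ≤ C * h ^ 2 := by
    rw [abs_div, abs_two]; linarith [abs_nonneg b₀]
  have hm : |m₀ + b₀ * (2 * f - 1) / 2| ≤ C * h + R * (C * h ^ 2) := by
    refine (abs_add_le _ _).trans (add_le_add (hD1 i₀) ?_)
    rw [show b₀ * (2 * f - 1) / 2 = (2 * f - 1) * (b₀ / 2) by ring, abs_mul]
    refine mul_le_mul ?_ hb (abs_nonneg _) (by positivity)
    rw [abs_le]; constructor <;> linarith [hfb.1, hfb.2]
  set ρ : ℤ → ℝ := fun i => s i - s i₀ - m₀ * (i - i₀) - b₀ * ((i - i₀) * (i - i₀ - 1) / 2) with hρ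
  have hρb : ∀ i, |2 * i - K| ≤ R → |ρ i| ≤ R ^ 3 * (C * h ^ 3) := fun i hi => by
    refine (abs_sub_quadratic_le hD3 R (abs_sub_half_le hi)).trans (le_of_eq ?_)
    ring
  set m := m₀ + b₀ * (2 * f - 1) / 2 with hmdef
  set e := s i₀ + m₀ * f + b₀ * (f * (f - 1)) / 2 - X with he
  have hid : ∀ i, s i - X = m * centered q K i + b₀ / 2 * centered q K i ^ 2 + e + ρ i := fun i => by
    rw [he, hmdef, hρ, hf]
    simp only [centered]
    rw [← hκ]
    ring
  have hSe : 0 = b₀ / 2 * bspline (q + 3) (fun i => centered q K i ^ 2) K + e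
      + bspline (q + 3) ρ K := by
    rw [← bspline_sub_self_apply (q + 3) s K, ← hX]
    simp only [hid]
    rw [bspline_add, bspline_add, bspline_add, bspline_const, bspline_const_mul, bspline_const_mul,
      bspline_centered]
    ring
  have hSξ : |bspline (q + 3) (fun i => centered q K i ^ 2) K| ≤ R ^ 2 :=
    abs_bspline_le_const _ fun i hi => by
      have := abs_centered_le hR (K := K) (i := i) (by push_cast at hi; omega)
      rw [abs_pow]
      gcongr
  have hSρ : |bspline (q + 3) ρ K| ≤ R ^ 3 * (C * h ^ 3) :=
    abs_bspline_le_const _ fun i hi => hρb i (by push_cast at hi; omega)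
  have heb : |e| ≤ R ^ 2 * (C * h ^ 2) + R ^ 3 * (C * h ^ 3) := by
    have h1 : e = -(b₀ / 2 * bspline (q + 3) (fun i => centered q K i ^ 2) K)
        - bspline (q + 3) ρ K := by linarith
    rw [h1]
    refine (abs_sub _ _).trans (add_le_add ?_ hSρ)
    rw [abs_neg, abs_mul, mul_comm]
    gcongr
  have hp1 : R * (C * h ^ 2) ≤ R ^ 3 * (C * h) := by
    have : (R : ℝ) ≤ R ^ 3 := le_self_pow₀ hR0 (by norm_num)
    gcongr
  have hp2 : C * h ≤ R ^ 3 * (C * h) := le_mul_of_one_le_left hC hR3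
  have hp3 : C * h ^ 2 ≤ R ^ 3 * (C * h ^ 2) := le_mul_of_one_le_left hC2 hR3
  have hp4 : R ^ 2 * (C * h ^ 2) ≤ R ^ 3 * (C * h ^ 2) := by
    have : (R : ℝ) ^ 2 ≤ R ^ 3 := pow_le_pow_right₀ hR0 (by norm_num)
    gcongr
  have hp5 : (R : ℝ) ^ 3 * (C * h ^ 3) ≤ R ^ 3 * (C * h ^ 2) := by gcongr
  have hp6 : 0 ≤ (R : ℝ) ^ 3 * (C * h ^ 3) := by positivity
  have hp7 : 0 ≤ (R : ℝ) ^ 3 * (C * h) := by positivity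
  refine ⟨m, b₀ / 2, e, ?_, ?_, ?_, fun i hi => ?_⟩
  · linarith
  · linarith
  · linarith
  · rw [hid, add_sub_cancel_left]
    linarith [hρb i hi]

/-- A scheme reproducing cubics maps the recentred powers of nearly quadratic data to small
quantities. -/
lemma abs_subdivision_moments_le {a : ℤ →₀ ℝ} {R : ℕ} (hR : ∀ m ∈ a.support, |m| ≤ R)
    (hR1 : 1 ≤ R) {K : ℤ} {ξ x : ℤ → ℝ} {m b e C h : ℝ} (hh : 0 ≤ h) (hh1 : h ≤ 1) (hC : 1 ≤ C)
    (t0 : subdivision a (fun _ => (1 : ℝ)) K = 1) (t1 : subdivision a ξ K = 0)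
    (t2 : subdivision a (fun i => ξ i ^ 2) K = 0) (t3 : subdivision a (fun i => ξ i ^ 3) K = 0)
    (hξ : ∀ i, |2 * i - K| ≤ R → |ξ i| ≤ R) (hm : |m| ≤ C * h) (hb : |b| ≤ C * h ^ 2)
    (he : |e| ≤ C * h ^ 2)
    (hx : ∀ i, |2 * i - K| ≤ R → |x i - (m * ξ i + b * ξ i ^ 2 + e)| ≤ C * h ^ 3) :
    |subdivision a x K| ≤ (1 + ∑ m ∈ a.support, |a m|) * (C * h ^ 2) ∧
    |subdivision a (fun i => x i ^ 2) K|
      ≤ (1 + ∑ m ∈ a.support, |a m|) * (8 * C ^ 2 * R ^ 4 * h ^ 4) ∧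
    |subdivision a (fun i => x i ^ 3) K|
      ≤ (1 + ∑ m ∈ a.support, |a m|) * (144 * C ^ 3 * R ^ 6 * h ^ 4) := by
  set W := ∑ m ∈ a.support, |a m|
  have hW : 0 ≤ W := Finset.sum_nonneg fun _ _ => abs_nonneg _
  set ρ : ℤ → ℝ := fun i => x i - (m * ξ i + b * ξ i ^ 2 + e) with hρ
  have hr1 : (1 : ℝ) ≤ R := by exact_mod_cast hR1
  have hr2 : (1 : ℝ) ≤ (R : ℝ) ^ 2 := one_le_pow₀ hr1
  have hr12 : (R : ℝ) ≤ R ^ 2 := by nlinarith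
  have hr24 : (R : ℝ) ^ 2 ≤ R ^ 4 := by nlinarith
  have hr4 : (1 : ℝ) ≤ (R : ℝ) ^ 4 := one_le_pow₀ hr1
  have hh2 : h ^ 2 ≤ h := by nlinarith
  have hh3 : h ^ 3 ≤ h ^ 2 := by nlinarith [sq_nonneg h]
  have hC0 : 0 ≤ C := by linarith
  have g1 : C * h ^ 2 ≤ C * R ^ 2 * h := by
    calc C * h ^ 2 = C * 1 * h ^ 2 := by ring
      _ ≤ C * R ^ 2 * h := by gcongr
  have g2 : C * h ^ 2 ≤ C * R ^ 2 * h ^ 2 := by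
    calc C * h ^ 2 = C * 1 * h ^ 2 := by ring
      _ ≤ C * R ^ 2 * h ^ 2 := by gcongr
  have g3 : C * h ^ 3 ≤ C * h ^ 2 := by gcongr
  have hbounds : ∀ i, |2 * i - K| ≤ R → |m * ξ i| ≤ C * R ^ 2 * h ∧
      |b * ξ i ^ 2| ≤ C * R ^ 2 * h ^ 2 := fun i hi => by
    have h1 := hξ i hi
    constructor
    · rw [abs_mul]
      calc |m| * |ξ i| ≤ (C * h) * R ^ 2 := by gcongr; exact h1.trans hr12
        _ = _ := by ring
    · rw [abs_mul, abs_pow]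
      calc |b| * |ξ i| ^ 2 ≤ (C * h ^ 2) * R ^ 2 := by gcongr
        _ = _ := by ring
  have hlow : C * R ^ 2 * h ^ 2 ≤ C * R ^ 2 * h := by gcongr
  refine ⟨?_, ?_, ?_⟩
  · have h1 : subdivision a x K = e + subdivision a ρ K := by
      have h2 : x = fun i => (m * ξ i + b * ξ i ^ 2 + e * 1) + ρ i := by
        funext i; simp only [hρ]; ring
      rw [h2, subdivision_add, subdivision_add, subdivision_add, subdivision_const_mul,
        subdivision_const_mul, subdivision_const_mul, t0]
      rw [show subdivision a (fun i => ξ i) K = 0 from t1, t2]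
      ring
    rw [h1]
    have h3 := abs_subdivision_le a hR (K := K) hx (by positivity)
    refine (abs_add_le _ _).trans ?_
    have : W * (C * h ^ 3) ≤ W * (C * h ^ 2) := by gcongr
    change |subdivision a ρ K| ≤ _ at h3
    linarith
  · set z : ℤ → ℝ := fun i => b ^ 2 * ξ i ^ 4 + ρ i * (2 * (m * ξ i + b * ξ i ^ 2 + e) + ρ i) with hz
    have h1 : subdivision a (fun i => x i ^ 2) K = e ^ 2 + subdivision a z K := by
      have h2 : (fun i => x i ^ 2) = fun i => ((m ^ 2 + 2 * e * b) * ξ i ^ 2 + (2 * m * b) * ξ i ^ 3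
          + (2 * e * m) * ξ i + e ^ 2 * 1) + z i := by
        funext i; simp only [hz, hρ]; ring
      rw [h2, subdivision_add, subdivision_add, subdivision_add, subdivision_add,
        subdivision_const_mul, subdivision_const_mul, subdivision_const_mul, subdivision_const_mul,
        t0, t3, t2]
      rw [show subdivision a (fun i => ξ i) K = 0 from t1]
      ring
    rw [h1]
    have h3 := abs_subdivision_le a hR (K := K) (x := z) (C := 8 * C ^ 2 * R ^ 4 * h ^ 4)
      (fun i hi => by
        obtain ⟨p1, p2⟩ := hbounds i hi
        have h4 := hx i hi
        change |ρ i| ≤ _ at h4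
        have h5 : |b ^ 2 * ξ i ^ 4| ≤ C ^ 2 * R ^ 4 * h ^ 4 := by
          rw [show b ^ 2 * ξ i ^ 4 = (b * ξ i ^ 2) ^ 2 by ring, abs_pow,
            show C ^ 2 * (R : ℝ) ^ 4 * h ^ 4 = (C * R ^ 2 * h ^ 2) ^ 2 by ring]
          gcongr
        have h6 : |2 * (m * ξ i + b * ξ i ^ 2 + e) + ρ i| ≤ 7 * (C * R ^ 2 * h) := by
          rw [abs_le] at *
          constructor <;> linarith [p1.1, p1.2, p2.1, p2.2, he.1, he.2, h4.1, h4.2]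
        have h7 : |ρ i * (2 * (m * ξ i + b * ξ i ^ 2 + e) + ρ i)|
            ≤ C * h ^ 3 * (7 * (C * R ^ 4 * h)) := by
          rw [abs_mul]
          refine mul_le_mul h4 (h6.trans ?_) (abs_nonneg _) (by positivity)
          gcongr
        refine ((abs_add_le _ _).trans (add_le_add h5 h7)).trans (le_of_eq ?_)
        ring) (by positivity)
    have h8 : |e ^ 2| ≤ 8 * C ^ 2 * R ^ 4 * h ^ 4 := by
      rw [abs_pow]
      calc |e| ^ 2 ≤ (C * h ^ 2) ^ 2 := by gcongr
        _ = 1 * C ^ 2 * 1 * h ^ 4 := by ring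
        _ ≤ _ := by gcongr; norm_num
    refine (abs_add_le _ _).trans ?_
    linarith
  · have h1 : subdivision a (fun i => x i ^ 3) K
        = subdivision a (fun i => x i ^ 3 - m ^ 3 * ξ i ^ 3) K := by
      rw [subdivision_sub, subdivision_const_mul, t3, mul_zero, sub_zero]
    rw [h1]
    have h3 := abs_subdivision_le a hR (K := K) (x := fun i => x i ^ 3 - m ^ 3 * ξ i ^ 3)
      (C := 144 * C ^ 3 * R ^ 6 * h ^ 4)
      (fun i hi => by
        obtain ⟨p1, p2⟩ := hbounds i hi
        have h4 := hx i hi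
        have hxb : |x i| ≤ 4 * C * R ^ 2 * h := by
          rw [abs_le] at *
          constructor <;> linarith [p1.1, p1.2, p2.1, p2.2, he.1, he.2, h4.1, h4.2]
        have hmb : |m * ξ i| ≤ 4 * C * R ^ 2 * h := by
          have : 0 ≤ C * R ^ 2 * h := by positivity
          linarith
        have hdb : |x i - m * ξ i| ≤ 3 * (C * R ^ 2 * h ^ 2) := by
          rw [abs_le] at *
          constructor <;> linarith [p1.1, p1.2, p2.1, p2.2, he.1, he.2, h4.1, h4.2]
        rw [← mul_pow]
        refine (abs_cube_sub_cube_le hxb hmb).trans ?_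
        calc 3 * (4 * C * (R : ℝ) ^ 2 * h) ^ 2 * |x i - m * ξ i|
            ≤ 3 * (4 * C * (R : ℝ) ^ 2 * h) ^ 2 * (3 * (C * R ^ 2 * h ^ 2)) := by gcongr
          _ = _ := by ring) (by positivity)
    refine h3.trans ?_
    have : 0 ≤ 144 * C ^ 3 * R ^ 6 * h ^ 4 := by positivity
    linarith

lemma interpolant_grid (j : ℕ) (x : ℤ → ℝ) (i : ℤ) : interpolant j x (i / 2 ^ j) = x i := by
  rw [interpolant, mul_div_cancel₀ _ (by positivity : (2 : ℝ) ^ j ≠ 0), Int.floor_intCast,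
    Int.fract_intCast]
  ring

lemma uniformContinuous_of_periodic {f : ℝ → ℝ} {c : ℝ} (hc : 0 < c) (hp : Function.Periodic f c)
    (hf : Continuous f) : UniformContinuous f := by
  have hK := (isCompact_Icc (a := -c) (b := 2 * c)).uniformContinuousOn_of_continuous hf.continuousOn
  rw [Metric.uniformContinuousOn_iff] at hK
  refine Metric.uniformContinuous_iff.2 fun ε hε => ?_
  obtain ⟨δ, hδ, h⟩ := hK ε hε
  refine ⟨min δ c, lt_min hδ hc, fun {x y} hxy => ?_⟩
  obtain ⟨h1, h2⟩ := lt_min_iff.1 hxy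
  set z : ℤ := ⌊x / c⌋
  have e1 : z * c ≤ x := (le_div_iff₀ hc).1 (Int.floor_le _)
  have e2 : x < (z + 1) * c := (div_lt_iff₀ hc).1 (Int.lt_floor_add_one _)
  rw [Real.dist_eq, abs_lt] at h2
  rw [← hp.sub_int_mul_eq z (x := x), ← hp.sub_int_mul_eq z (x := y)]
  refine h _ ⟨by linarith, by linarith⟩ _ ⟨by linarith [h2.2], by linarith [h2.1]⟩ ?_
  rwa [dist_sub_right]

/-- The limit of a convergent quasi-periodic sequence of interpolants is uniformly continuous. -/
lemma uniformContinuous_of_quasiperiodic {s : ℕ → ℤ → ℝ} {L : ℝ} {n : ℕ} (hn : 0 < n)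
    (hcl : ∀ j i, s j (i + 2 ^ j * n) = s j i + L) {σ : ℝ → ℝ} (hσ : Continuous σ)
    (hlim : TendstoUniformly (fun j t => interpolant j (s j) t) σ atTop) : UniformContinuous σ := by
  have hper : ∀ j t, interpolant j (s j) (t + n) = interpolant j (s j) t + L := by
    intro j t
    have h1 : (2 : ℝ) ^ j * (t + n) = 2 ^ j * t + ((2 ^ j * n : ℤ) : ℝ) := by push_cast; ring
    rw [interpolant, interpolant, h1, Int.floor_add_intCast, Int.fract_add_intCast, hcl,
      show ⌊(2 : ℝ) ^ j * t⌋ + 2 ^ j * (n : ℤ) + 1 = (⌊(2 : ℝ) ^ j * t⌋ + 1) + 2 ^ j * n by ring, hcl]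
    ring
  have hσper : ∀ t, σ (t + n) = σ t + L := fun t => by
    have h1 := hlim.tendsto_at (t + n)
    simp only [hper] at h1
    exact tendsto_nhds_unique h1 ((hlim.tendsto_at t).add_const L)
  have hn0 : (n : ℝ) ≠ 0 := by positivity
  have hg : UniformContinuous fun t => σ t - L / n * t := by
    refine uniformContinuous_of_periodic (c := (n : ℝ)) (by positivity) (fun t => ?_) (by fun_prop)
    rw [hσper]
    field_simp
    ring
  have hl : UniformContinuous fun t : ℝ => L / n * t :=
    Real.uniformContinuous_const_mul
  simpa using hg.add hl

lemma exists_close_of_converges {s : ℕ → ℤ → ℝ} {L : ℝ} {n : ℕ} (hn : 0 < n)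
    (hcl : ∀ j i, s j (i + 2 ^ j * n) = s j i + L) (hconv : Converges s) (R : ℕ) {ε : ℝ}
    (hε : 0 < ε) :
    ∃ j₀, ∀ j ≥ j₀, ∀ K i : ℤ, |2 * i - K| ≤ R → |s (j + 1) K - s j i| ≤ ε := by
  obtain ⟨σ, hσ, hlim⟩ := hconv
  have huc := uniformContinuous_of_quasiperiodic hn hcl hσ hlim
  obtain ⟨δ, hδ, hδσ⟩ := Metric.uniformContinuous_iff.1 huc (ε / 3) (by positivity)
  obtain ⟨j₁, hj₁⟩ := eventually_atTop.1 (Metric.tendstoUniformly_iff.1 hlim (ε / 3) (by positivity))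
  have hR : Tendsto (fun j : ℕ => (R : ℝ) * (1 / 2 : ℝ) ^ (j + 1)) atTop (𝓝 0) := by
    have := ((tendsto_pow_atTop_nhds_zero_of_lt_one (by norm_num : (0 : ℝ) ≤ 1 / 2)
      (by norm_num)).comp (tendsto_add_atTop_nat 1)).const_mul (R : ℝ)
    simpa using this
  obtain ⟨j₂, hj₂⟩ := eventually_atTop.1 (hR.eventually_lt_const hδ)
  refine ⟨max j₁ j₂, fun j hj K i hi => ?_⟩
  have e1 := hj₁ (j + 1) (by omega) (K / 2 ^ (j + 1))
  have e2 := hj₁ j (by omega) (i / 2 ^ j)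
  rw [interpolant_grid, Real.dist_eq] at e1 e2
  have e3 : dist ((K : ℝ) / 2 ^ (j + 1)) (i / 2 ^ j) < δ := by
    refine lt_of_le_of_lt ?_ (hj₂ j (by omega))
    have h1 : (K : ℝ) / 2 ^ (j + 1) - i / 2 ^ j = -((2 * i - K : ℤ) : ℝ) * (1 / 2) ^ (j + 1) := by
      push_cast
      rw [div_pow, one_pow, pow_succ]
      field_simp
      ring
    rw [Real.dist_eq, h1, abs_mul, abs_neg, abs_of_pos (by positivity : (0 : ℝ) < (1 / 2) ^ (j + 1))]
    have : |((2 * i - K : ℤ) : ℝ)| ≤ R := by exact_mod_cast hi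
    gcongr
  have e4 := hδσ e3
  rw [Real.dist_eq] at e4
  rw [abs_lt] at e1 e2 e4
  rw [abs_le]
  constructor <;> linarith [e1.1, e1.2, e2.1, e2.2, e4.1, e4.2]

lemma abs_sub_bspline_le_of_delta {q R : ℕ} (hR : q + 6 ≤ R) {s : ℤ → ℝ} {e : ℝ}
    (he : ∀ i, |delta s i| ≤ e) {K i : ℤ} (hi : |2 * i - K| ≤ R) :
    |s i - bspline (q + 3) s K| ≤ 2 * R * e := by
  have h1 : ∀ i, |2 * i - K| ≤ R → |s i - s (K / 2)| ≤ R * e := fun i hi =>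
    abs_sub_le_of_abs_delta_le (fun i _ => he i) i (abs_sub_half_le hi)
  have h2 : |bspline (q + 3) (fun i => s i - s (K / 2)) K| ≤ R * e :=
    abs_bspline_le_const _ fun i hi => h1 i (by push_cast at hi; omega)
  rw [bspline_sub, bspline_const] at h2
  have h3 := h1 i hi
  rw [abs_le] at *
  constructor <;> linarith [h2.1, h2.2, h3.1, h3.2]

/-- First estimate of the averaged direction, from first differences only. -/
lemma TaylorBounds.norm_direction_le (hT : TaylorBounds γ γ₁ γ₂ γ₃ M) {q R : ℕ} (hR : q + 6 ≤ R)
    {s : ℤ → ℝ} (hs : StrictMono s) {e : ℝ} (he : ∀ i, |delta s i| ≤ e) (he0 : 24 * M * R * e ≤ 1)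
    (K : ℤ) :
    ‖bspline (q + 1) (delta fun i => γ (s i)) K
        - bspline (q + 1) (delta s) K • γ₁ (bspline (q + 3) s K)‖
      ≤ (3 * M * (2 * R * e)) * bspline (q + 1) (delta s) K := by
  have hM := hT.one_le
  set X := bspline (q + 3) s K
  set A := 2 * R * e with hA
  have he1 : 0 ≤ e := (abs_nonneg _).trans (he 0)
  have hA0 : 0 ≤ A := by positivity
  have hMA : 12 * (M * A) ≤ 1 := by rw [hA]; linarith
  have hA1 : A ≤ 1 := by nlinarith
  have hwin : ∀ i, |2 * i - K| ≤ R → |s i - X| ≤ A := fun i hi =>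
    abs_sub_bspline_le_of_delta hR he hi
  have hℓ : 0 < bspline (q + 1) (delta s) K :=
    bspline_pos _ (fun i => sub_pos.2 (hs (by omega))) K
  have h := hT.norm_bspline_delta_sub_le (q + 1) hs (K := K) (X := X) (A := A) (B := 2 * A)
    (fun i hi => hwin i (by push_cast at hi; omega)) (by
      rw [← bspline_const_mul]
      refine abs_bspline_le _ fun i hi => ?_
      have a1 := hwin i (by push_cast at hi; omega)
      have a2 := hwin (i + 1) (by rw [abs_le] at *; push_cast at hi; omega)
      have hds0 : 0 < delta s i := sub_pos.2 (hs (by omega))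
      have hid : delta (fun i => (s i - X) ^ 2) i
          = ((s i - X) + (s (i + 1) - X)) * delta s i := by
        simp only [delta]; ring
      rw [hid, abs_mul, abs_of_pos hds0]
      refine mul_le_mul_of_nonneg_right ?_ hds0.le
      exact (abs_add_le _ _).trans (by linarith))
  refine h.trans (mul_le_mul_of_nonneg_right ?_ hℓ.le)
  have : A ^ 2 ≤ A := by nlinarith
  nlinarith

lemma TaylorBounds.abs_displacement_le (hT : TaylorBounds γ γ₁ γ₂ γ₃ M) {q R : ℕ} (hR : q + 6 ≤ R)
    {s : ℤ → ℝ} (hs : StrictMono s) {e : ℝ} (he : ∀ i, |delta s i| ≤ e) (he0 : 24 * M * R * e ≤ 1)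
    {K : ℤ} {t : ℝ} (ht : M * |t - bspline (q + 3) s K| ≤ 1 / 4)
    (horth : inner ℝ (γ t - bspline (q + 3) (fun i => γ (s i)) K)
      (bspline (q + 1) (delta fun i => γ (s i)) K) = 0) :
    |t - bspline (q + 3) s K| ≤ 120 * M ^ 2 * R ^ 3 * e ^ 3 := by
  have hM := hT.one_le
  have he1 : 0 ≤ e := (abs_nonneg _).trans (he 0)
  have hℓ : 0 < bspline (q + 1) (delta s) K :=
    bspline_pos _ (fun i => sub_pos.2 (hs (by omega))) K
  have hw := hT.norm_direction_le hR hs he he0 K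
  set A := 2 * R * e with hA
  have hA0 : 0 ≤ A := by positivity
  have hMA : 12 * (M * A) ≤ 1 := by rw [hA]; linarith
  have hA1 : A ≤ 1 := by nlinarith
  have hwin : ∀ i, |2 * i - K| ≤ ((q + 3 : ℕ) : ℤ) + 1 → |s i - bspline (q + 3) s K| ≤ A :=
    fun i hi => abs_sub_bspline_le_of_delta hR he (by push_cast at hi; omega)
  have h := hT.abs_sub_bspline_le rfl hwin (B := A ^ 3)
    (abs_bspline_le_const _ fun i hi => by
      have := hwin i hi
      rw [abs_pow]
      gcongr) hℓ hw (by linarith) ht horth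
  refine h.trans ?_
  have h4 : A ^ 4 ≤ M * A ^ 3 := by
    calc A ^ 4 = A * A ^ 3 := by ring
      _ ≤ M * A ^ 3 := by gcongr; linarith
  have h3 : A ^ 3 ≤ M * A ^ 3 := le_mul_of_one_le_left (by positivity) hM
  calc 3 * M * (A ^ 3 + A ^ 4 + 3 * M * A * A ^ 2) ≤ 3 * M * (5 * (M * A ^ 3)) := by
        gcongr
        linarith [(by ring : 3 * M * A * A ^ 2 = 3 * (M * A ^ 3))]
    _ = _ := by rw [hA]; ring

/-- Second estimate of the averaged direction, from second differences. -/
lemma TaylorBounds.exists_norm_direction_le (hT : TaylorBounds γ γ₁ γ₂ γ₃ M) {q R : ℕ}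
    (hR : q + 6 ≤ R) {s : ℤ → ℝ} (hs : StrictMono s) {e C h : ℝ} (he : ∀ i, |delta s i| ≤ e)
    (he0 : 24 * M * R * e ≤ 1) (hD1 : ∀ i, |delta s i| ≤ C * h)
    (hD2 : ∀ i, |delta (delta s) i| ≤ C * h ^ 2) (K : ℤ) :
    ∃ θ, θ ≤ 1 / 4 ∧
      θ ≤ M * ((12 * R + 2) * (2 * (R * (R * C))) + (2 * R * C) ^ 2) * h ^ 2 ∧
      ‖bspline (q + 1) (delta fun i => γ (s i)) K
        - bspline (q + 1) (delta s) K • γ₁ (bspline (q + 3) s K)‖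
      ≤ θ * bspline (q + 1) (delta s) K := by
  have h1 := hT.norm_direction_le hR hs he he0 K
  have h2 := hT.norm_bspline_delta_sub_le (q + 1) hs (A := 2 * R * (C * h))
    (fun i hi => abs_sub_bspline_le_of_delta hR hD1 (by push_cast at hi; omega))
    (abs_bspline_delta_sq_le hR hs hD2 K)
  rcases le_total (3 * M * (2 * R * e))
    (M * ((12 * R + 2) * (2 * (R * (R * (C * h ^ 2)))) + (2 * R * (C * h)) ^ 2)) with hle | hle
  · exact ⟨_, by linarith, hle.trans (le_of_eq (by ring)), h1⟩
  · exact ⟨_, hle.trans (by linarith), le_of_eq (by ring), h2⟩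

lemma TaylorBounds.exists_displacement_bound (hT : TaylorBounds γ γ₁ γ₂ γ₃ M) {q R : ℕ}
    (hR : q + 6 ≤ R) {C : ℝ} (hC : 0 ≤ C) :
    ∃ C', 0 ≤ C' ∧ ∀ {s : ℤ → ℝ} {e h t : ℝ} {K : ℤ}, StrictMono s → 0 ≤ h →
      (∀ i, |delta s i| ≤ e) → 24 * M * R * e ≤ 1 → (∀ i, |delta s i| ≤ C * h) →
      (∀ i, |delta (delta s) i| ≤ C * h ^ 2) → M * |t - bspline (q + 3) s K| ≤ 1 / 4 →
      inner ℝ (γ t - bspline (q + 3) (fun i => γ (s i)) K)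
        (bspline (q + 1) (delta fun i => γ (s i)) K) = 0 →
      |t - bspline (q + 3) s K| ≤ C' * h ^ 4 := by
  have hM := hT.one_le
  refine ⟨3 * M * (24 * R ^ 4 * C ^ 3 + (2 * R * C) ^ 4 +
    M * ((12 * R + 2) * (2 * (R * (R * C))) + (2 * R * C) ^ 2) * (2 * R * C) ^ 2), by positivity, ?_⟩
  intro s e h t K hs hh he he0 hD1 hD2 ht horth
  obtain ⟨θ, hθ1, hθ2, hw⟩ := hT.exists_norm_direction_le hR hs he he0 hD1 hD2 K
  have hℓ : 0 < bspline (q + 1) (delta s) K :=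
    bspline_pos _ (fun i => sub_pos.2 (hs (by omega))) K
  have hA := fun i (hi : |2 * i - K| ≤ R) => abs_sub_bspline_le_of_delta hR hD1 hi
  have hm : |delta s (K / 2)| * R ≤ 2 * R * (C * h) := by
    have h1 := hD1 (K / 2)
    have h2 : (0 : ℝ) ≤ R * (C * h) := by positivity
    nlinarith [(by positivity : (0 : ℝ) ≤ R)]
  have hmain := hT.abs_sub_bspline_le rfl
    (fun i hi => hA i (by push_cast at hi; omega)) (abs_bspline_cube_le hR hm hA hD2) hℓ hw hθ1
    ht horth
  refine hmain.trans ?_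
  calc _ ≤ 3 * M * (3 * (2 * R * (C * h)) ^ 2 * (2 * (R * (R * (C * h ^ 2))))
        + (2 * R * (C * h)) ^ 4 + (M * ((12 * R + 2) * (2 * (R * (R * C))) + (2 * R * C) ^ 2) * h ^ 2)
          * (2 * R * (C * h)) ^ 2) := by gcongr
    _ = _ := by ring

lemma TaylorBounds.exists_detail_bound (hT : TaylorBounds γ γ₁ γ₂ γ₃ M) {q R : ℕ}
    (hR : q + 6 ≤ R) {a : ℤ →₀ ℝ} (haR : ∀ m ∈ a.support, |m| ≤ R)
    (ht0 : ∀ K, subdivision a (fun _ => (1 : ℝ)) K = 1)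
    (ht : ∀ k ∈ Finset.Icc 1 3, ∀ K, subdivision a (fun i => centered q K i ^ k) K = 0)
    {C C' : ℝ} (hC : 1 ≤ C) (hC' : 0 ≤ C') :
    ∃ C'', 0 ≤ C'' ∧ ∀ {s : ℤ → ℝ} {e h t d : ℝ} {K : ℤ}, StrictMono s → 0 ≤ h → h ≤ 1 →
      (∀ i, |delta s i| ≤ e) → 24 * M * R * e ≤ 1 → (∀ i, |delta s i| ≤ C * h) →
      (∀ i, |delta (delta s) i| ≤ C * h ^ 2) → (∀ i, |delta (delta (delta s)) i| ≤ C * h ^ 3) →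
      M * |t - bspline (q + 3) s K| ≤ 1 / 4 → |t - bspline (q + 3) s K| ≤ C' * h ^ 4 →
      γ t = predicted (bspline (q + 3)) (bspline (q + 1)) (subdivision a) (fun i => γ (s i)) K
        + d • approxNormal (bspline (q + 1)) (fun i => γ (s i)) K →
      |d| ≤ C'' * h ^ 4 := by
  have hM := hT.one_le
  set W := ∑ m ∈ a.support, |a m| with hW
  have hW0 : 0 ≤ W := Finset.sum_nonneg fun _ _ => abs_nonneg _
  set P := M * ((12 * R + 2) * (2 * (R * (R * C))) + (2 * R * C) ^ 2) with hP
  set Q := 4 * (R : ℝ) ^ 3 * C with hQ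
  have hR1 : (1 : ℝ) ≤ R := by exact_mod_cast (by omega : 1 ≤ R)
  have hQ1 : 1 ≤ Q := by
    have : (1 : ℝ) ≤ (R : ℝ) ^ 3 := one_le_pow₀ hR1
    nlinarith
  have hP0 : 0 ≤ P := by positivity
  refine ⟨2 * C' + P * ((1 + W) * Q) + M * ((1 + W) * (8 * Q ^ 2 * R ^ 4))
    + M * ((1 + W) * (144 * Q ^ 3 * R ^ 6)) + W * (M * (2 * R * C) ^ 4), by positivity, ?_⟩
  intro s e h t d K hs hh hh1 he he0 hD1 hD2 hD3 hts hts4 hstep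
  obtain ⟨θ, hθ1, hθ2, hw⟩ := hT.exists_norm_direction_le hR hs he he0 hD1 hD2 K
  have hℓ : 0 < bspline (q + 1) (delta s) K :=
    bspline_pos _ (fun i => sub_pos.2 (hs (by omega))) K
  obtain ⟨m, b, c, hm, hb, hc, hx⟩ := exists_quadratic_approx hR hh hh1 hD1 hD2 hD3 K
  obtain ⟨m1, m2, m3⟩ := abs_subdivision_moments_le haR (by omega) hh hh1 hQ1 (ht0 K)
    (by simpa using ht 1 (by simp) K) (ht 2 (by simp) K) (ht 3 (by simp) K)
    (fun i hi => abs_centered_le hR hi) hm hb hc hx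
  have hmain := hT.abs_detail_le haR (ht0 K)
    (fun i (hi : |2 * i - K| ≤ R) => abs_sub_bspline_le_of_delta hR hD1 hi) hℓ hw hθ1 hts hstep
  refine hmain.trans ?_
  calc _ ≤ 2 * (C' * h ^ 4) + (P * h ^ 2) * ((1 + W) * (Q * h ^ 2))
        + M * ((1 + W) * (8 * Q ^ 2 * R ^ 4 * h ^ 4))
        + M * ((1 + W) * (144 * Q ^ 3 * R ^ 6 * h ^ 4)) + W * (M * (2 * R * (C * h)) ^ 4) := by
        gcongr
    _ = _ := by ring

/-- Differences of perturbed B-spline data. -/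
lemma abs_delta_perturbed_le {q : ℕ} {s s' : ℤ → ℝ} {Y : ℝ}
    (hY : ∀ K, |s' K - bspline (q + 3) s K| ≤ Y) :
    (∀ e, (∀ i, |delta s i| ≤ e) → ∀ i, |delta s' i| ≤ 1 / 2 * e + 2 * Y) ∧
    (∀ e, (∀ i, |delta (delta s) i| ≤ e) → ∀ i, |delta (delta s') i| ≤ 1 / 4 * e + 4 * Y) ∧
    (∀ e, (∀ i, |delta (delta (delta s)) i| ≤ e) →
      ∀ i, |delta (delta (delta s')) i| ≤ 1 / 8 * e + 8 * Y) := by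
  set y : ℤ → ℝ := fun K => s' K - bspline (q + 3) s K with hy
  have hδ : ∀ (z : ℤ → ℝ) (B : ℝ), (∀ i, |z i| ≤ B) → ∀ i, |delta z i| ≤ 2 * B := fun z B hz i =>
    (abs_sub _ _).trans (by linarith [hz i, hz (i + 1)])
  have y1 := hδ y Y hY
  have y2 := hδ _ _ y1
  have y3 := hδ _ _ y2
  have hstep : ∀ (p : ℕ) (c : ℝ) (x z : ℤ → ℝ),
      delta (fun K => c * bspline (p + 1) x K + z K)
        = fun K => c / 2 * bspline p (delta x) K + delta z K := by
    intro p c x z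
    funext K
    have := delta_bspline p x K
    simp only [delta, smul_eq_mul] at this ⊢
    linear_combination c * this
  have h0 : s' = fun K => 1 * bspline (q + 3) s K + y K := by
    funext K; simp only [hy]; ring
  have h1 : delta s' = fun K => 1 / 2 * bspline (q + 2) (delta s) K + delta y K := by
    rw [h0, hstep]
  have h2 : delta (delta s')
      = fun K => 1 / 2 / 2 * bspline (q + 1) (delta (delta s)) K + delta (delta y) K := by
    rw [h1, hstep]
  have h3 : delta (delta (delta s'))
      = fun K => 1 / 2 / 2 / 2 * bspline q (delta (delta (delta s))) K
        + delta (delta (delta y)) K := by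
    rw [h2, hstep]
  refine ⟨fun e he i => ?_, fun e he i => ?_, fun e he i => ?_⟩
  · rw [h1]
    refine (abs_add_le _ _).trans (add_le_add ?_ (y1 i))
    rw [abs_mul, abs_of_pos (by norm_num)]
    have := abs_bspline_le_const (q + 2) (K := i) fun k _ => he k
    linarith
  · rw [h2]
    refine (abs_add_le _ _).trans (add_le_add ?_ ((y2 i).trans (by linarith)))
    rw [abs_mul, abs_of_pos (by norm_num)]
    have := abs_bspline_le_const (q + 1) (K := i) fun k _ => he k
    linarith
  · rw [h3]
    refine (abs_add_le _ _).trans (add_le_add ?_ ((y3 i).trans (by linarith)))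
    rw [abs_mul, abs_of_pos (by norm_num)]
    have := abs_bspline_le_const q (K := i) fun k _ => he k
    linarith

lemma inner_sub_bspline_eq_zero {S N T : (ℤ → Plane) → ℤ → Plane} {v : ℤ → Plane} {K : ℤ} {d : ℝ}
    {x : Plane} (h : x = predicted S N T v K + d • approxNormal N v K) :
    inner ℝ (x - S v K) (N (delta v) K) = 0 := by
  have hn : inner ℝ (approxNormal N v K) (N (delta v) K) = 0 := by
    rw [approxNormal, real_inner_smul_left, inner_perp_self, mul_zero]
  rw [h, predicted, add_assoc, add_sub_cancel_left, inner_add_left, real_inner_smul_left,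
    real_inner_smul_left, hn, mul_zero, mul_zero, add_zero]

/-- Detail decay along a tail on which the data are already fine. -/
lemma TaylorBounds.exists_detail_decay (hT : TaylorBounds γ γ₁ γ₂ γ₃ M) {q R : ℕ}
    (hR : q + 6 ≤ R) {a : ℤ →₀ ℝ} (haR : ∀ m ∈ a.support, |m| ≤ R)
    (ht0 : ∀ K, subdivision a (fun _ => (1 : ℝ)) K = 1)
    (ht : ∀ k ∈ Finset.Icc 1 3, ∀ K, subdivision a (fun i => centered q K i ^ k) K = 0)
    {u d : ℕ → ℤ → ℝ} (hu : ∀ k, StrictMono (u k)) {η : ℝ} (hη : η = 1 / (100 * M * R ^ 2))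
    (hclose : ∀ k (K i : ℤ), |2 * i - K| ≤ R → |u (k + 1) K - u k i| ≤ η / 2)
    (hstep : ∀ k K, γ (u (k + 1) K) =
      predicted (bspline (q + 3)) (bspline (q + 1)) (subdivision a) (fun i => γ (u k i)) K
        + d k K • approxNormal (bspline (q + 1)) (fun i => γ (u k i)) K) :
    ∃ C, ∀ k K, |d k K| ≤ C * (1 / 16) ^ k := by
  have hM := hT.one_le
  have hR6 : (6 : ℝ) ≤ R := by exact_mod_cast (by omega : 6 ≤ R)
  have hη0 : 0 < η := by rw [hη]; positivity
  have hηR : 100 * (M * R ^ 2) * η = 1 := by rw [hη]; field_simp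
  have hηR1 : 50 * (M * R * (2 * η)) ≤ 1 := by
    have h1 : M * R * (2 * η) ≤ M * R ^ 2 * (2 * η) := by
      have : (R : ℝ) ≤ R ^ 2 := le_self_pow₀ (by linarith) (by norm_num)
      gcongr
    linarith
  have horth := fun k K => inner_sub_bspline_eq_zero (hstep k K)
  have hnear : ∀ k K, M * |u (k + 1) K - bspline (q + 3) (u k) K| ≤ 1 / 4 := by
    intro k K
    have h1 : |bspline (q + 3) (fun i => u (k + 1) K - u k i) K| ≤ η / 2 :=
      abs_bspline_le_const _ fun i hi => hclose k K i (by push_cast at hi; omega)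
    rw [bspline_sub, bspline_const] at h1
    have h2 : M * |u (k + 1) K - bspline (q + 3) (u k) K| ≤ M * (η / 2) := by gcongr
    have h3 : M * η ≤ M * R * η := by
      have : M * 1 ≤ M * R := by gcongr; linarith
      nlinarith
    linarith
  have hdisp : ∀ k e, (∀ i, |delta (u k) i| ≤ e) → e ≤ 2 * η →
      ∀ K, |u (k + 1) K - bspline (q + 3) (u k) K| ≤ 120 * M ^ 2 * R ^ 3 * e ^ 3 := by
    intro k e he he2 K
    refine hT.abs_displacement_le hR (hu k) he ?_ (hnear k K) (horth k K)
    have he1 : 0 ≤ e := (abs_nonneg _).trans (he 0)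
    have h1 : M * R * e ≤ M * R * (2 * η) := by gcongr
    have h2 : 0 ≤ M * R * e := by positivity
    linarith
  have hfirst : ∀ k i, |delta (u k) i| ≤ η * (1 / 2) ^ k * (2 - (1 / 2) ^ k) := by
    intro k
    induction k with
    | zero =>
      intro i
      have h1 := hclose 0 (2 * i) i (by simp)
      have h2 := hclose 0 (2 * i) (i + 1) (by
        rw [show 2 * (i + 1) - 2 * i = 2 by ring]
        rw [abs_le]; omega)
      rw [delta]
      rw [abs_le] at *
      constructor <;> linarith [h1.1, h1.2, h2.1, h2.2]
    | succ k ih =>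
      intro i
      set h : ℝ := (1 / 2) ^ k with hh
      have h0 : 0 < h := by positivity
      have h1 : h ≤ 1 := pow_le_one₀ (by norm_num) (by norm_num)
      have he : η * h * (2 - h) ≤ 2 * η * h := by nlinarith [mul_pos hη0 h0]
      have he' : 2 * η * h ≤ 2 * η := by nlinarith
      have hd := hdisp k _ ih (he.trans he')
      have hb := (abs_delta_perturbed_le hd).1 _ ih i
      refine hb.trans ?_
      have he0 : 0 ≤ η * h * (2 - h) := by have : 0 ≤ 2 - h := by linarith
                                           positivity
      have hc : 120 * M ^ 2 * R ^ 3 * (η * h * (2 - h)) ^ 3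
          ≤ 120 * M ^ 2 * R ^ 3 * (2 * η * h) ^ 3 := by gcongr
      have hs : 120 * M ^ 2 * (R : ℝ) ^ 3 * (2 * η * h) ^ 3 ≤ η * h ^ 2 / 8 := by
        have r1 : (M * R ^ 2 * η) = 1 / 100 := by linarith
        have r2 : M ^ 2 * (R : ℝ) ^ 3 * η ^ 2 ≤ 1 / 10000 := by
          calc M ^ 2 * (R : ℝ) ^ 3 * η ^ 2 ≤ M ^ 2 * (R : ℝ) ^ 4 * η ^ 2 := by
                have : (R : ℝ) ^ 3 ≤ R ^ 4 := pow_le_pow_right₀ (by linarith) (by norm_num)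
                gcongr
            _ = (M * R ^ 2 * η) ^ 2 := by ring
            _ = 1 / 10000 := by rw [r1]; norm_num
        have r3 : h ^ 3 ≤ h ^ 2 := pow_le_pow_of_le_one h0.le h1 (by norm_num)
        calc 120 * M ^ 2 * (R : ℝ) ^ 3 * (2 * η * h) ^ 3
            = 960 * (M ^ 2 * (R : ℝ) ^ 3 * η ^ 2) * (η * h ^ 3) := by ring
          _ ≤ 960 * (1 / 10000) * (η * h ^ 2) := by gcongr
          _ ≤ η * h ^ 2 / 8 := by nlinarith [mul_pos hη0 (pow_pos h0 2)]
      rw [pow_succ (1 / 2 : ℝ) k, ← hh]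
      linarith [(by ring : η * (h * (1 / 2)) * (2 - h * (1 / 2))
        = 1 / 2 * (η * h * (2 - h)) + η * h ^ 2 / 4)]
  have hfirst' : ∀ k i, |delta (u k) i| ≤ 2 * η * (1 / 2) ^ k := fun k i => by
    refine (hfirst k i).trans ?_
    have h0 : (0 : ℝ) < (1 / 2) ^ k := by positivity
    nlinarith [mul_pos hη0 h0]
  have hfine : ∀ k i, |delta (u k) i| ≤ 2 * η := fun k i => by
    refine (hfirst' k i).trans ?_
    have h1 : (1 / 2 : ℝ) ^ k ≤ 1 := pow_le_one₀ (by norm_num) (by norm_num)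
    nlinarith
  have hη24 : 24 * M * R * (2 * η) ≤ 1 := by
    have : 0 ≤ M * R * (2 * η) := by positivity
    linarith
  have hδ : ∀ (z : ℤ → ℝ) (B : ℝ), (∀ i, |z i| ≤ B) → ∀ i, |delta z i| ≤ 2 * B := fun z B hz i =>
    (abs_sub _ _).trans (by linarith [hz i, hz (i + 1)])
  have hhalf : ∀ (k m : ℕ), ((1 / 2 : ℝ) ^ k) ^ m = ((1 / 2) ^ m) ^ k := fun k m => by
    rw [← pow_mul, ← pow_mul, mul_comm]
  obtain ⟨B2, hB2, hsecond⟩ := exists_geometric_bound (u := fun k => delta (delta (u k)))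
    (q := 1 / 4) (C := 4 * (120 * M ^ 2 * R ^ 3 * (2 * η) ^ 3)) (by norm_num) (by positivity)
    (hδ _ _ (hfine 0)) (fun k e he i => by
      have hd := hdisp k _ (hfirst' k) (by
        have h1 : (1 / 2 : ℝ) ^ k ≤ 1 := pow_le_one₀ (by norm_num) (by norm_num)
        nlinarith)
      refine ((abs_delta_perturbed_le hd).2.1 e he i).trans (le_of_eq ?_)
      rw [mul_pow (2 * η), hhalf]
      norm_num
      ring)
  set C := 1 + 2 * η + B2 with hC
  have hC1 : 1 ≤ C := by rw [hC]; linarith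
  have hD1 : ∀ k i, |delta (u k) i| ≤ C * (1 / 2) ^ k := fun k i =>
    (hfirst' k i).trans (by gcongr; rw [hC]; linarith)
  have hD2 : ∀ k i, |delta (delta (u k)) i| ≤ C * ((1 / 2) ^ k) ^ 2 := fun k i => by
    refine (hsecond k i).trans ?_
    rw [hhalf, show ((1 / 2 : ℝ)) ^ 2 = 1 / 4 by norm_num]
    gcongr
    rw [hC]; linarith
  obtain ⟨C', hC', hdisp2⟩ := hT.exists_displacement_bound hR (zero_le_one.trans hC1)
  have hd4 : ∀ k K, |u (k + 1) K - bspline (q + 3) (u k) K| ≤ C' * ((1 / 2) ^ k) ^ 4 := fun k K =>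
    hdisp2 (hu k) (by positivity) (hfine k) hη24 (hD1 k) (hD2 k) (hnear k K) (horth k K)
  obtain ⟨B3, hB3, hthird⟩ := exists_geometric_bound (u := fun k => delta (delta (delta (u k))))
    (q := 1 / 8) (C := 8 * C') (by norm_num) (by positivity)
    (hδ _ _ (hδ _ _ (hfine 0))) (fun k e he i => by
      refine ((abs_delta_perturbed_le (hd4 k)).2.2 e he i).trans (le_of_eq ?_)
      rw [hhalf]
      norm_num
      ring)
  obtain ⟨C'', -, hfinal⟩ := hT.exists_detail_bound hR haR ht0 ht (C := C + B3) (C' := C')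
    (by linarith) hC'
  refine ⟨C'', fun k K => ?_⟩
  have h := hfinal (hu k) (by positivity) (pow_le_one₀ (n := k) (by norm_num)
    (by norm_num : (1 / 2 : ℝ) ≤ 1)) (hfine k) hη24
    (fun i => (hD1 k i).trans (by gcongr; linarith))
    (fun i => (hD2 k i).trans (by gcongr; linarith))
    (fun i => (hthird k i).trans (by
      rw [hhalf, show ((1 / 2 : ℝ)) ^ 3 = 1 / 8 by norm_num]
      gcongr; linarith)) (hnear k K) (hd4 k K) (hstep k K)
  rwa [hhalf, show ((1 / 2 : ℝ)) ^ 4 = 1 / 16 by norm_num] at h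

end NormalMT

end

theorem theorem4p1
    (p : ℕ) (hp : 3 ≤ p)
    -- the curve: closed, non-self-intersecting, `C^4`, strictly convex
    (γ : ℝ → NormalMT.Plane) (L : ℝ) (hγ : NormalMT.IsClosedCurve γ L)
    (hC4 : ContDiff ℝ 4 γ) (hconv : NormalMT.StrictlyConvex γ)
    -- the number of initial points
    (n : ℕ) (hn : ⌈(p : ℝ) / 2⌉₊ + 1 ≤ n)
    -- the scheme `T` with mask `a`, of exact reproduction order `Pe ≥ 4` and with the shift
    -- parameter `c` of `S_p`
    (a : ℤ →₀ ℝ) (Pe : ℕ) (hPe : 4 ≤ Pe) (c : ℝ)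
    (hc : NormalMT.ReproducesExactly (NormalMT.bspline p) 2 c)
    (hT : NormalMT.ReproducesExactly (NormalMT.subdivision a) Pe c)
    -- the convergent `(S_p, S_{p-2}, T)` normal multi-scale transform
    (s d : ℕ → ℤ → ℝ)
    (hMT : NormalMT.IsNormalMT (NormalMT.bspline p) (NormalMT.bspline (p - 2))
      (NormalMT.subdivision a) γ L n s d)
    (hconvergent : NormalMT.Converges s) :
    ∃ C : ℝ, ∀ᶠ j : ℕ in Filter.atTop, ∀ K : ℤ, |d j K| ≤ C * (2 : ℝ) ^ (-(4 * (j : ℤ))) := by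
  open NormalMT in
  obtain ⟨q, rfl⟩ := Nat.exists_eq_add_of_le' hp
  have hcq : c = (q + 2) / 4 := by
    have h := hc Polynomial.X (by rw [Polynomial.degree_X]; norm_num) 0
    simp only [Polynomial.eval_X] at h
    rw [show q + 3 = (q + 2) + 1 by ring, bspline_linear] at h
    push_cast at h
    linarith
  obtain ⟨γ₁, γ₂, γ₃, M, hB⟩ := exists_taylorBounds hγ hC4
  set R : ℕ := q + 6 + a.support.sup Int.natAbs with hR
  have haR : ∀ m ∈ a.support, |m| ≤ R := fun m hm => by
    have := Finset.le_sup (f := Int.natAbs) hm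
    rw [abs_le]
    omega
  have ht0 : ∀ K, subdivision a (fun _ => (1 : ℝ)) K = 1 := fun K => by
    have h := hT 1 (lt_of_le_of_lt Polynomial.degree_one_le (by exact_mod_cast (by omega : 0 < Pe))) K
    simpa only [Polynomial.eval_one] using h
  have ht : ∀ k ∈ Finset.Icc 1 3, ∀ K, subdivision a (fun i => centered q K i ^ k) K = 0 := by
    intro k hk K
    rw [Finset.mem_Icc] at hk
    have h := hT ((Polynomial.X - Polynomial.C ((K : ℝ) / 2 + (q + 2) / 4)) ^ k) (by
      rw [Polynomial.degree_pow, Polynomial.degree_X_sub_C, nsmul_eq_mul, mul_one]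
      exact_mod_cast (by omega : k < Pe)) K
    simp only [Polynomial.eval_pow, Polynomial.eval_sub, Polynomial.eval_X, Polynomial.eval_C] at h
    rw [hcq, sub_self, zero_pow (by omega)] at h
    exact h
  have hM := hB.one_le
  have hR0 : (0 : ℝ) < R := by exact_mod_cast (by omega : 0 < R)
  obtain ⟨j₀, hj₀⟩ := exists_close_of_converges (by omega) hMT.closed hconvergent R
    (ε := 1 / (100 * M * R ^ 2) / 2) (by positivity)
  obtain ⟨C, hC⟩ := hB.exists_detail_decay (by omega) haR ht0 ht (u := fun k => s (j₀ + k))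
    (d := fun k => d (j₀ + k + 1)) (fun k => hMT.ordered _) rfl
    (fun k K i hi => hj₀ (j₀ + k) (by omega) K i hi) (fun k K => hMT.step (j₀ + k) K)
  refine ⟨C * 16 ^ (j₀ + 1), Filter.eventually_atTop.2 ⟨j₀ + 1, fun j hj K => ?_⟩⟩
  obtain ⟨k, rfl⟩ := Nat.exists_eq_add_of_le hj
  have h := hC k K
  rw [show j₀ + k + 1 = j₀ + 1 + k by ring] at h
  refine h.trans (le_of_eq ?_)
  have h16 : (2 : ℝ) ^ (-(4 * ((j₀ + 1 + k : ℕ) : ℤ))) = (1 / 16) ^ (j₀ + 1 + k) := by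
    rw [← mul_neg, zpow_mul, zpow_neg, zpow_natCast, one_div, inv_pow]
    norm_num
  rw [h16, pow_add (1 / 16 : ℝ) (j₀ + 1) k, one_div, inv_pow 16 (j₀ + 1)]
  field_simp
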